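/- Let $X,Y$ be zero-mean jointly Gaussian random vectors in $\mathbb R^{n_x},\mathbb R^{n_y}$ with covariances $\Sigma_X,\Sigma_Y\succ0$ and cross-covariances $\Sigma_{XY}=\Sigma_{YX}^T$. Let $X^*=\mathbb E[X|Y]$ with covariance $\Sigma_{X^*}$, let all roots of positive semidefinite matrices be positive semidefinite, and let $$(G^*)^2=\mathrm{Tr}\{\Sigma_X+\Sigma_{X^*}-2(\Sigma_X^{1/2}\Sigma_{X^*}\Sigma_X^{1/2})^{1/2}\},\qquad G^*\ge 0 .$$ An estimator is a random vector $\hat X$ in $\mathbb R^{n_x}$ with finite second moment that is generated from $Y$ by a conditional distribution $p_{\hat X|Y}$, independently of $X$ given $Y$. Let $W_2$ be the Wasserstein-2 distance and, for $P\ge0$, $$D(P)=\inf_{p_{\hat X|Y}}\{\mathbb E\|X-\hat X\|^2 : W_2(p_X,p_{\hat X})\le P\}.$$ An estimator $\hat X$ is called optimal with perception index $P$ if $W_2(p_X,p_{\hat X})=P$ and $\mathbb E\|X-\hat X\|^2=D(P)$. (a) Let $\Sigma_{\hat X_0Y}\in\mathbb R^{n_x\times n_y}$ satisfy $$\Sigma_{\hat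 X_0Y}\Sigma_Y^{-1}\Sigma_{YX}=\Sigma_X^{1/2}(\Sigma_X^{1/2}\Sigma_{X^*}\Sigma_X^{1/2})^{1/2}\Sigma_X^{-1/2},\tag{1}$$ $$\Sigma_{W_0}:=\Sigma_X-\Sigma_{\hat X_0Y}\Sigma_Y^{-1}\Sigma_{\hat X_0Y}^T\succeq0,\tag{2}$$ and let $W_0\sim\mathcal N(0,\Sigma_{W_0})$ be independent of $(X,Y)$. Then for every $P\in[0,G^*]$ $$\hat X_P=\Big(\big(1-\tfrac P{G^*}\big)\Sigma_{\hat X_0Y}+\tfrac P{G^*}\Sigma_{XY}\Big)\Sigma_Y^{-1}Y+\big(1-\tfrac P{G^*}\big)W_0$$ is an optimal estimator with perception index $P$ (where $P/G^*$ is read as $0$ if $G^*=0$). (b) Let $T^*=\Sigma_X^{-1/2}(\Sigma_X^{1/2}\Sigma_{X^*}\Sigma_X^{1/2})^{1/2}\Sigma_X^{-1/2}$ and let $\Sigma_{X^*}^\dagger$ be the Moore–Penrose inverse of $\Sigma_{X^*}$. The estimator $$\Big(\big(1-\tfrac P{G^*}\big)\Sigma_X^{1/2}(\Sigma_X^{1/2}\Sigma_{X^*}\Sigma_X^{1/2})^{1/2}\Sigma_X^{-1/2}\Sigma_{X^*}^\dagger+\tfrac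 P{G^*}I\Big)\Sigma_{XY}\Sigma_Y^{-1}Y+\big(1-\tfrac P{G^*}\big)W,$$ with $W$ Gaussian of mean zero and covariance $\Sigma_W=\Sigma_X^{1/2}(I-\Sigma_X^{1/2}T^*\Sigma_{X^*}^\dagger T^*\Sigma_X^{1/2})\Sigma_X^{1/2}$ and independent of $(X,Y)$, is of the form in (a): the matrix $M^\dagger=\Sigma_X^{1/2}(\Sigma_X^{1/2}\Sigma_{X^*}\Sigma_X^{1/2})^{1/2}\Sigma_X^{-1/2}\Sigma_{X^*}^\dagger\Sigma_{XY}$ solves (1)–(2), $\Sigma_W=\Sigma_X-M^\dagger\Sigma_Y^{-1}(M^\dagger)^T$, and the estimator equals $\hat X_P$ for $\Sigma_{\hat X_0Y}=M^\dagger$, $W_0=W$. (c) This solution is in general not unique: if $\operatorname{rank}\Sigma_{XY}<\min(n_x,n_y)$, then (1)–(2) have a solution other than $M^\dagger$; and for all $n_x,n_y\ge1$ there are $X,Y$ as above for which (1)–(2) have a solution other than $M^\dagger$. -/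

import Mathlib

open MeasureTheory ProbabilityTheory
open scoped ENNReal MatrixOrder

noncomputable section

namespace DP

/-! ### Transport distance, Gelbrich distance, matrix pseudo-inverse -/

/-- Wasserstein-2 distance, `W₂²(μ, ν) = inf E‖U - V‖²` over all couplings of `μ` and `ν`. -/
def W2 {E : Type*} [NormedAddCommGroup E] [MeasurableSpace E] (μ ν : Measure E) : ℝ≥0∞ :=
  (⨅ π ∈ {π : Measure (E × E) | IsProbabilityMeasure π ∧ π.map Prod.fst = μ ∧
      π.map Prod.snd = ν}, ∫⁻ p, ‖p.1 - p.2‖ₑ ^ 2 ∂π) ^ (1 / 2 : ℝ)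

/-- Gelbrich distance between `(m₁, S₁)` and `(m₂, S₂)`. -/
def gelbrich {n : ℕ} (m₁ : EuclideanSpace ℝ (Fin n)) (S₁ : Matrix (Fin n) (Fin n) ℝ)
    (m₂ : EuclideanSpace ℝ (Fin n)) (S₂ : Matrix (Fin n) (Fin n) ℝ) : ℝ :=
  √(‖m₁ - m₂‖ ^ 2 +
    (S₁ + S₂ - (2 : ℝ) • CFC.sqrt (CFC.sqrt S₁ * S₂ * CFC.sqrt S₁)).trace)

/-- Moore–Penrose inverse of a real symmetric matrix: the nonzero eigenvalues are inverted, the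
kernel is kept (`0⁻¹ = 0`). -/
def pinv {n : ℕ} (A : Matrix (Fin n) (Fin n) ℝ) : Matrix (Fin n) (Fin n) ℝ :=
  cfc (fun x : ℝ => x⁻¹) A

/-- `pinv` satisfies the four Penrose equations, which characterize the Moore–Penrose inverse. -/
theorem pinv_penrose {n : ℕ} {A : Matrix (Fin n) (Fin n) ℝ} (hA : A.IsSymm) :
    A * pinv A * A = A ∧ pinv A * A * pinv A = pinv A ∧
      (A * pinv A).IsSymm ∧ (pinv A * A).IsSymm := by
  have hsa : IsSelfAdjoint A := by
    rw [IsSelfAdjoint, Matrix.star_eq_conjTranspose, Matrix.conjTranspose_eq_transpose_of_trivial]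
    exact hA
  have hc : ∀ f : ℝ → ℝ, ContinuousOn f (spectrum ℝ A) := fun f =>
    (Matrix.finite_real_spectrum (A := A)).continuousOn f
  have hid : cfc (fun x : ℝ => x) A = A := cfc_id' ℝ A
  have h1 : A * pinv A = cfc (fun x : ℝ => x * x⁻¹) A := by
    rw [cfc_mul _ _ A (hc _) (hc _), hid]; rfl
  have h2 : pinv A * A = cfc (fun x : ℝ => x⁻¹ * x) A := by
    rw [cfc_mul _ _ A (hc _) (hc _), hid]; rfl
  have hs : ∀ f : ℝ → ℝ, (cfc f A).IsSymm := fun f => by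
    have h : IsSelfAdjoint (cfc f A) := cfc_predicate f A
    rw [IsSelfAdjoint, Matrix.star_eq_conjTranspose,
      Matrix.conjTranspose_eq_transpose_of_trivial] at h
    exact h
  refine ⟨?_, ?_, h1 ▸ hs _, h2 ▸ hs _⟩
  · calc A * pinv A * A = cfc (fun x : ℝ => x * x⁻¹) A * cfc (fun x : ℝ => x) A := by rw [h1, hid]
      _ = cfc (fun x : ℝ => x * x⁻¹ * x) A := (cfc_mul _ _ A (hc _) (hc _)).symm
      _ = A := by simp only [mul_inv_mul_cancel, hid]
  · calc pinv A * A * pinv A = cfc (fun x : ℝ => x⁻¹ * x) A * cfc (fun x : ℝ => x⁻¹) A := by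
          rw [h2]; rfl
      _ = cfc (fun x : ℝ => x⁻¹ * x * x⁻¹) A := (cfc_mul _ _ A (hc _) (hc _)).symm
      _ = pinv A := by
          have h : ∀ x : ℝ, x⁻¹ * x * x⁻¹ = x⁻¹ := fun x => by simpa using mul_inv_mul_cancel x⁻¹
          simp only [h]; rfl

/-! ### Estimators and the distortion-perception function -/

variable {Ω : Type*} [MeasurableSpace Ω] {nx ny : ℕ}

/-- The distortion-perception function
`D(P) = inf { E‖X - X̂‖² : W₂(p_X, p_X̂) ≤ P }`, the infimum ranging over all conditional
distributions `κ = p_{X̂|Y}`. The triple `(X, Y, X̂)` has law `p_{XY}(dx, dy) κ(y, dx̂)`, that is,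
`X̂` is independent of `X` given `Y`; the law of `X̂` is `κ ∘ₘ p_Y`. (The constraint makes the second
moment of `X̂` finite as soon as that of `X` is.) -/
def dpFun (X : Ω → EuclideanSpace ℝ (Fin nx)) (Y : Ω → EuclideanSpace ℝ (Fin ny))
    (μ : Measure Ω) (P : ℝ) : ℝ≥0∞ :=
  ⨅ κ ∈ {κ : Kernel (EuclideanSpace ℝ (Fin ny)) (EuclideanSpace ℝ (Fin nx)) |
      IsMarkovKernel κ ∧ W2 (μ.map X) (κ ∘ₘ (μ.map Y)) ≤ ENNReal.ofReal P},
    ∫⁻ p, ‖p.1.1 - p.2‖ₑ ^ 2 ∂((μ.map (fun ω => (X ω, Y ω))) ⊗ₘ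
      (Kernel.prodMkLeft (EuclideanSpace ℝ (Fin nx)) κ))

/-- `Xhat` is an optimal estimator of `X` from `Y` with perception index `P`: it is generated from
`Y` by some conditional distribution `κ` (so it is independent of `X` given `Y`), has finite second
moment, achieves perception index `P`, and its mean squared error is `D(P)`. -/
structure IsOptimalEstimator (X : Ω → EuclideanSpace ℝ (Fin nx))
    (Y : Ω → EuclideanSpace ℝ (Fin ny)) (μ : Measure Ω) (P : ℝ)
    (Xhat : Ω → EuclideanSpace ℝ (Fin nx)) : Prop where
  estimator : ∃ κ : Kernel (EuclideanSpace ℝ (Fin ny)) (EuclideanSpace ℝ (Fin nx)),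
    IsMarkovKernel κ ∧ HasCondDistrib Xhat (fun ω => (X ω, Y ω))
      (Kernel.prodMkLeft (EuclideanSpace ℝ (Fin nx)) κ) μ
  memLp : MemLp Xhat 2 μ
  perception : W2 (μ.map X) (μ.map Xhat) = ENNReal.ofReal P
  distortion : ∫⁻ ω, ‖X ω - Xhat ω‖ₑ ^ 2 ∂μ = dpFun X Y μ P

/-! ### The Gaussian setting -/

/-- Cross-covariance matrix `Σ_{UV}`. -/
def crossCov {m n : ℕ} (U : Ω → EuclideanSpace ℝ (Fin m)) (V : Ω → EuclideanSpace ℝ (Fin n))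
    (μ : Measure Ω) : Matrix (Fin m) (Fin n) ℝ :=
  Matrix.of fun i j => cov[fun ω => U ω i, fun ω => V ω j; μ]

/-- Covariance matrix `Σ_U`. -/
def covMat {m : ℕ} (U : Ω → EuclideanSpace ℝ (Fin m)) (μ : Measure Ω) :
    Matrix (Fin m) (Fin m) ℝ :=
  crossCov U U μ

/-- `X` and `Y` are zero-mean jointly Gaussian random vectors with `Σ_X, Σ_Y ≻ 0`. -/
structure GaussianSetting (X : Ω → EuclideanSpace ℝ (Fin nx)) (Y : Ω → EuclideanSpace ℝ (Fin ny))
    (μ : Measure Ω) : Prop where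
  measurable_X : Measurable X
  measurable_Y : Measurable Y
  gaussian : HasGaussianLaw (fun ω => (X ω, Y ω)) μ
  mean_X : ∫ ω, X ω ∂μ = 0
  mean_Y : ∫ ω, Y ω ∂μ = 0
  posDef_X : (covMat X μ).PosDef
  posDef_Y : (covMat Y μ).PosDef

/-- The minimum mean squared error estimator `X* = E[X | Y]`. -/
def mmse (X : Ω → EuclideanSpace ℝ (Fin nx)) (Y : Ω → EuclideanSpace ℝ (Fin ny))
    (μ : Measure Ω) : Ω → EuclideanSpace ℝ (Fin nx) :=
  μ[X | MeasurableSpace.comap Y inferInstance]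

/-- `G*`, the Gelbrich distance between the first two moments of `X` and of `X*`. -/
def gStar (X : Ω → EuclideanSpace ℝ (Fin nx)) (Y : Ω → EuclideanSpace ℝ (Fin ny))
    (μ : Measure Ω) : ℝ :=
  gelbrich (∫ ω, X ω ∂μ) (covMat X μ) (∫ ω, mmse X Y μ ω ∂μ) (covMat (mmse X Y μ) μ)

/-- `(Σ_X^{1/2} Σ_{X*} Σ_X^{1/2})^{1/2}`. -/
def midRoot (X : Ω → EuclideanSpace ℝ (Fin nx)) (Y : Ω → EuclideanSpace ℝ (Fin ny))
    (μ : Measure Ω) : Matrix (Fin nx) (Fin nx) ℝ :=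
  CFC.sqrt (CFC.sqrt (covMat X μ) * covMat (mmse X Y μ) μ * CFC.sqrt (covMat X μ))

/-- `Σ_{W₀} = Σ_X - M Σ_Y⁻¹ Mᵀ`, where `M` stands for `Σ_{X̂₀Y}`. -/
def noiseCov (X : Ω → EuclideanSpace ℝ (Fin nx)) (Y : Ω → EuclideanSpace ℝ (Fin ny))
    (μ : Measure Ω) (M : Matrix (Fin nx) (Fin ny) ℝ) : Matrix (Fin nx) (Fin nx) ℝ :=
  covMat X μ - M * (covMat Y μ)⁻¹ * M.transpose

/-- The two conditions on `M = Σ_{X̂₀Y}`: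
`M Σ_Y⁻¹ Σ_{YX} = Σ_X^{1/2} (Σ_X^{1/2} Σ_{X*} Σ_X^{1/2})^{1/2} Σ_X^{-1/2}` and
`Σ_X - M Σ_Y⁻¹ Mᵀ ⪰ 0`. -/
structure IsSolution (X : Ω → EuclideanSpace ℝ (Fin nx)) (Y : Ω → EuclideanSpace ℝ (Fin ny))
    (μ : Measure Ω) (M : Matrix (Fin nx) (Fin ny) ℝ) : Prop where
  eq : M * (covMat Y μ)⁻¹ * crossCov Y X μ =
    CFC.sqrt (covMat X μ) * midRoot X Y μ * (CFC.sqrt (covMat X μ))⁻¹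
  posSemidef : (noiseCov X Y μ M).PosSemidef

/-- `W` is a zero-mean Gaussian vector with covariance `S`, independent of `(X, Y)`. -/
structure IsNoise (X : Ω → EuclideanSpace ℝ (Fin nx)) (Y : Ω → EuclideanSpace ℝ (Fin ny))
    (μ : Measure Ω) (S : Matrix (Fin nx) (Fin nx) ℝ) (W : Ω → EuclideanSpace ℝ (Fin nx)) :
    Prop where
  law : HasLaw W (multivariateGaussian 0 S) μ
  indep : IndepFun W (fun ω => (X ω, Y ω)) μ

/-- `X̂_P = ((1 - P/G*) M + (P/G*) Σ_{XY}) Σ_Y⁻¹ Y + (1 - P/G*) W`. -/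
def estimator (X : Ω → EuclideanSpace ℝ (Fin nx)) (Y : Ω → EuclideanSpace ℝ (Fin ny))
    (μ : Measure Ω) (M : Matrix (Fin nx) (Fin ny) ℝ) (W : Ω → EuclideanSpace ℝ (Fin nx))
    (P : ℝ) (ω : Ω) : EuclideanSpace ℝ (Fin nx) :=
  Matrix.toEuclideanLin
      (((1 - P / gStar X Y μ) • M + (P / gStar X Y μ) • crossCov X Y μ) * (covMat Y μ)⁻¹) (Y ω) +
    (1 - P / gStar X Y μ) • W ω

/-! The particular estimator built from the pseudo-inverse of `Σ_{X*}`. -/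

/-- `T* = Σ_X^{-1/2} (Σ_X^{1/2} Σ_{X*} Σ_X^{1/2})^{1/2} Σ_X^{-1/2}`. -/
def tStar (X : Ω → EuclideanSpace ℝ (Fin nx)) (Y : Ω → EuclideanSpace ℝ (Fin ny))
    (μ : Measure Ω) : Matrix (Fin nx) (Fin nx) ℝ :=
  (CFC.sqrt (covMat X μ))⁻¹ * midRoot X Y μ * (CFC.sqrt (covMat X μ))⁻¹

/-- `Σ_W = Σ_X^{1/2} (I - Σ_X^{1/2} T* Σ_{X*}† T* Σ_X^{1/2}) Σ_X^{1/2}`. -/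
def pinvNoiseCov (X : Ω → EuclideanSpace ℝ (Fin nx)) (Y : Ω → EuclideanSpace ℝ (Fin ny))
    (μ : Measure Ω) : Matrix (Fin nx) (Fin nx) ℝ :=
  CFC.sqrt (covMat X μ) *
    (1 - CFC.sqrt (covMat X μ) * tStar X Y μ * pinv (covMat (mmse X Y μ) μ) * tStar X Y μ *
      CFC.sqrt (covMat X μ)) *
    CFC.sqrt (covMat X μ)

/-- `((1 - P/G*) Σ_X^{1/2} (Σ_X^{1/2} Σ_{X*} Σ_X^{1/2})^{1/2} Σ_X^{-1/2} Σ_{X*}† + (P/G*) I)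
Σ_{XY} Σ_Y⁻¹ Y + (1 - P/G*) W`. -/
def pinvEstimator (X : Ω → EuclideanSpace ℝ (Fin nx)) (Y : Ω → EuclideanSpace ℝ (Fin ny))
    (μ : Measure Ω) (W : Ω → EuclideanSpace ℝ (Fin nx)) (P : ℝ) (ω : Ω) :
    EuclideanSpace ℝ (Fin nx) :=
  Matrix.toEuclideanLin
      (((1 - P / gStar X Y μ) • (CFC.sqrt (covMat X μ) * midRoot X Y μ *
          (CFC.sqrt (covMat X μ))⁻¹ * pinv (covMat (mmse X Y μ) μ)) +
        (P / gStar X Y μ) • (1 : Matrix (Fin nx) (Fin nx) ℝ)) *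
        crossCov X Y μ * (covMat Y μ)⁻¹) (Y ω) +
    (1 - P / gStar X Y μ) • W ω

/-- The cross-covariance `Σ_{X̂₀Y}` of that estimator,
`Σ_X^{1/2} (Σ_X^{1/2} Σ_{X*} Σ_X^{1/2})^{1/2} Σ_X^{-1/2} Σ_{X*}† Σ_{XY}`. -/
def pinvCrossCov (X : Ω → EuclideanSpace ℝ (Fin nx)) (Y : Ω → EuclideanSpace ℝ (Fin ny))
    (μ : Measure Ω) : Matrix (Fin nx) (Fin ny) ℝ :=
  CFC.sqrt (covMat X μ) * midRoot X Y μ * (CFC.sqrt (covMat X μ))⁻¹ *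
    pinv (covMat (mmse X Y μ) μ) * crossCov X Y μ

end DP

end

noncomputable section

set_option linter.unusedSectionVars false

namespace DP

/-! ### Matrix square roots and the optimal transport map between covariances -/

section Matrices

variable {n m : ℕ} {S V : Matrix (Fin n) (Fin n) ℝ}

theorem isUnit_det_sqrt (hS : S.PosDef) : IsUnit (CFC.sqrt S).det := by
  rw [← Matrix.isUnit_iff_isUnit_det]
  exact (CFC.isUnit_sqrt_iff S hS.posSemidef.nonneg).2 hS.isUnit

theorem posSemidef_sqrt (A : Matrix (Fin n) (Fin n) ℝ) : (CFC.sqrt A).PosSemidef :=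
  Matrix.nonneg_iff_posSemidef.1 (CFC.sqrt_nonneg A)

theorem transpose_sqrt (A : Matrix (Fin n) (Fin n) ℝ) :
    (CFC.sqrt A).transpose = CFC.sqrt A := by
  have h := (posSemidef_sqrt A).isHermitian
  rwa [Matrix.IsHermitian, Matrix.conjTranspose_eq_transpose_of_trivial] at h

/-- The symmetric matrix `T = S^{-1/2} (S^{1/2} V S^{1/2})^{1/2} S^{-1/2}`, which transports the
covariance `S` to the covariance `V`. -/
def transportMatrix (S V : Matrix (Fin n) (Fin n) ℝ) : Matrix (Fin n) (Fin n) ℝ :=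
  (CFC.sqrt S)⁻¹ * CFC.sqrt (CFC.sqrt S * V * CFC.sqrt S) * (CFC.sqrt S)⁻¹

theorem posSemidef_transportMatrix (S V : Matrix (Fin n) (Fin n) ℝ) :
    (transportMatrix S V).PosSemidef := by
  have h := (posSemidef_sqrt (CFC.sqrt S * V * CFC.sqrt S)).mul_mul_conjTranspose_same
    (CFC.sqrt S)⁻¹
  rwa [Matrix.conjTranspose_eq_transpose_of_trivial, Matrix.transpose_nonsing_inv,
    transpose_sqrt] at h

theorem transpose_transportMatrix (S V : Matrix (Fin n) (Fin n) ℝ) :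
    (transportMatrix S V).transpose = transportMatrix S V := by
  have h := (posSemidef_transportMatrix S V).isHermitian
  rwa [Matrix.IsHermitian, Matrix.conjTranspose_eq_transpose_of_trivial] at h

theorem mul_transportMatrix (hS : S.PosDef) :
    S * transportMatrix S V =
      CFC.sqrt S * CFC.sqrt (CFC.sqrt S * V * CFC.sqrt S) * (CFC.sqrt S)⁻¹ := by
  have hS' := CFC.sqrt_mul_sqrt_self S hS.posSemidef.nonneg
  nth_rewrite 1 [← hS']
  simp only [transportMatrix, ← Matrix.mul_assoc,
    Matrix.mul_nonsing_inv_cancel_right _ _ (isUnit_det_sqrt hS)]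

theorem trace_mul_transportMatrix (hS : S.PosDef) :
    (S * transportMatrix S V).trace = (CFC.sqrt (CFC.sqrt S * V * CFC.sqrt S)).trace := by
  rw [mul_transportMatrix hS, Matrix.trace_mul_comm, ← Matrix.mul_assoc,
    Matrix.nonsing_inv_mul _ (isUnit_det_sqrt hS), Matrix.one_mul]

theorem transportMatrix_mul_mul (hS : S.PosDef) (hV : V.PosSemidef) :
    transportMatrix S V * S * transportMatrix S V = V := by
  have hu := isUnit_det_sqrt hS
  have hp : 0 ≤ CFC.sqrt S * V * CFC.sqrt S := by
    have h := hV.mul_mul_conjTranspose_same (CFC.sqrt S)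
    rw [Matrix.conjTranspose_eq_transpose_of_trivial, transpose_sqrt] at h
    exact h.nonneg
  rw [Matrix.mul_assoc, mul_transportMatrix hS, transportMatrix]
  set Q := CFC.sqrt S
  set R := CFC.sqrt (Q * V * Q)
  have hR : R * R = Q * V * Q := CFC.sqrt_mul_sqrt_self _ hp
  calc Q⁻¹ * R * Q⁻¹ * (Q * R * Q⁻¹) = Q⁻¹ * R * (Q⁻¹ * Q) * R * Q⁻¹ := by
        simp only [Matrix.mul_assoc]
    _ = Q⁻¹ * (R * R) * Q⁻¹ := by
        rw [Matrix.nonsing_inv_mul _ hu]; simp only [Matrix.mul_assoc, Matrix.one_mul]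
    _ = (Q⁻¹ * Q) * V * (Q * Q⁻¹) := by rw [hR]; simp only [Matrix.mul_assoc]
    _ = V := by
        rw [Matrix.nonsing_inv_mul _ hu, Matrix.mul_nonsing_inv _ hu, Matrix.one_mul,
          Matrix.mul_one]

theorem transportMatrix_mul_eq_zero (hS : S.PosDef) (hV : V.PosSemidef)
    {N : Matrix (Fin n) (Fin m) ℝ} (hN : V * N = 0) : transportMatrix S V * N = 0 := by
  set T := transportMatrix S V with hT
  have hz : (CFC.sqrt S * T * N).transpose * (CFC.sqrt S * T * N) = 0 := by
    calc (CFC.sqrt S * T * N).transpose * (CFC.sqrt S * T * N)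
        = N.transpose * (T * (CFC.sqrt S * CFC.sqrt S) * T * N) := by
          simp only [Matrix.transpose_mul, transpose_sqrt, hT, transpose_transportMatrix,
            Matrix.mul_assoc]
      _ = 0 := by
          rw [CFC.sqrt_mul_sqrt_self S hS.posSemidef.nonneg, hT, transportMatrix_mul_mul hS hV,
            hN, Matrix.mul_zero]
  rw [← Matrix.conjTranspose_eq_transpose_of_trivial,
    Matrix.conjTranspose_mul_self_eq_zero] at hz
  calc T * N = (CFC.sqrt S)⁻¹ * (CFC.sqrt S * T * N) := by
        rw [← Matrix.mul_assoc, ← Matrix.mul_assoc,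
          Matrix.nonsing_inv_mul _ (isUnit_det_sqrt hS), Matrix.one_mul]
    _ = 0 := by rw [hz, Matrix.mul_zero]

/-- The regularization `T + ε` of the transport matrix gives nearly optimal dual potentials. -/
theorem trace_regularized_le (hS : S.PosDef) (hV : V.PosSemidef) {ε : ℝ} (hε : 0 < ε) :
    ((transportMatrix S V + ε • (1 : Matrix (Fin n) (Fin n) ℝ)) * S).trace +
      ((transportMatrix S V + ε • (1 : Matrix (Fin n) (Fin n) ℝ))⁻¹ * V).trace ≤
    2 * (CFC.sqrt (CFC.sqrt S * V * CFC.sqrt S)).trace + ε * S.trace := by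
  have hT := posSemidef_transportMatrix S V
  have hTt := transpose_transportMatrix S V
  have hV' := transportMatrix_mul_mul hS hV
  rw [← trace_mul_transportMatrix hS]
  set T := transportMatrix S V
  set K := T + ε • (1 : Matrix (Fin n) (Fin n) ℝ) with hK
  have hKp : K.PosDef := Matrix.PosDef.posSemidef_add hT (Matrix.PosDef.one.smul hε)
  have hKu : IsUnit K.det := (Matrix.isUnit_iff_isUnit_det _).1 hKp.isUnit
  have hKt : K⁻¹.transpose = K⁻¹ := by
    rw [Matrix.transpose_nonsing_inv, hK]; simp [hTt]
  have hcomm : T * K = K * T := by simp [hK, Matrix.mul_add, Matrix.add_mul]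
  have hcomm' : K⁻¹ * T = T * K⁻¹ := by
    calc K⁻¹ * T = K⁻¹ * (T * K) * K⁻¹ := by
          rw [Matrix.mul_assoc, Matrix.mul_assoc, Matrix.mul_nonsing_inv _ hKu, Matrix.mul_one]
      _ = T * K⁻¹ := by rw [hcomm, ← Matrix.mul_assoc, Matrix.nonsing_inv_mul _ hKu,
          Matrix.one_mul]
  have hKT : T = K - ε • (1 : Matrix (Fin n) (Fin n) ℝ) := by simp [hK]
  have hdef : (K⁻¹ * T).PosSemidef := by
    have h4 : (T * T + ε • T).PosSemidef := by
      have := (Matrix.posSemidef_conjTranspose_mul_self T).add (hT.smul hε.le)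
      rwa [Matrix.conjTranspose_eq_transpose_of_trivial, hTt] at this
    have h5 := h4.mul_mul_conjTranspose_same K⁻¹
    rw [Matrix.conjTranspose_eq_transpose_of_trivial, hKt] at h5
    have h6 : T * T + ε • T = T * K := by simp [hK, Matrix.mul_add]
    rwa [h6, Matrix.mul_assoc, Matrix.mul_assoc, Matrix.mul_nonsing_inv _ hKu,
      Matrix.mul_one] at h5
  have hle : 0 ≤ (CFC.sqrt S * (K⁻¹ * T) * CFC.sqrt S).trace := by
    have h := (hdef.mul_mul_conjTranspose_same (CFC.sqrt S)).trace_nonneg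
    rwa [Matrix.conjTranspose_eq_transpose_of_trivial, transpose_sqrt] at h
  have htr : (CFC.sqrt S * (K⁻¹ * T) * CFC.sqrt S).trace = (S * (K⁻¹ * T)).trace := by
    rw [Matrix.trace_mul_comm, ← Matrix.mul_assoc,
      CFC.sqrt_mul_sqrt_self S hS.posSemidef.nonneg]
  have e1 : (K * S).trace = (S * T).trace + ε * S.trace := by
    simp [hK, Matrix.add_mul, Matrix.trace_mul_comm T S]
  have e2 : (K⁻¹ * V).trace = (S * T).trace - ε * (S * (K⁻¹ * T)).trace := by
    have : T * K⁻¹ * T = T - ε • (K⁻¹ * T) := by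
      rw [eq_sub_iff_add_eq, ← hcomm', Matrix.mul_assoc, ← Matrix.mul_smul, ← Matrix.mul_add]
      have h6 : T * T + ε • T = K * T := by simp [hK, Matrix.add_mul]
      rw [h6, ← Matrix.mul_assoc, Matrix.nonsing_inv_mul _ hKu, Matrix.one_mul]
    rw [← hV', ← Matrix.mul_assoc, Matrix.trace_mul_comm, ← Matrix.mul_assoc,
      ← Matrix.mul_assoc, Matrix.trace_mul_comm, this]
    simp [Matrix.mul_sub]
  rw [e1, e2]
  rw [htr] at hle
  nlinarith [mul_nonneg hε.le hle]

theorem transpose_pinv {A : Matrix (Fin n) (Fin n) ℝ} : (pinv A).transpose = pinv A := by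
  have h : IsSelfAdjoint (pinv A) := cfc_predicate _ A
  rwa [IsSelfAdjoint, Matrix.star_eq_conjTranspose,
    Matrix.conjTranspose_eq_transpose_of_trivial] at h

theorem isSymm_of_posSemidef (hV : V.PosSemidef) : V.IsSymm := by
  have h := hV.isHermitian
  rwa [Matrix.IsHermitian, Matrix.conjTranspose_eq_transpose_of_trivial] at h

theorem transportMatrix_mul_pinv_mul (hS : S.PosDef) (hV : V.PosSemidef) :
    transportMatrix S V * (pinv V * V) = transportMatrix S V := by
  have h : V * (1 - pinv V * V) = 0 := by
    rw [Matrix.mul_sub, Matrix.mul_one, ← Matrix.mul_assoc,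
      (pinv_penrose (isSymm_of_posSemidef hV)).1, sub_self]
  have h' := transportMatrix_mul_eq_zero hS hV h
  rw [Matrix.mul_sub, Matrix.mul_one, sub_eq_zero] at h'
  exact h'.symm

/-- The orthogonal projection onto the range of `S^{1/2} T`. -/
def rangeProj (S V : Matrix (Fin n) (Fin n) ℝ) : Matrix (Fin n) (Fin n) ℝ :=
  CFC.sqrt S * transportMatrix S V * pinv V * transportMatrix S V * CFC.sqrt S

theorem transpose_rangeProj : (rangeProj S V).transpose = rangeProj S V := by
  simp only [rangeProj, Matrix.transpose_mul, transpose_sqrt, transpose_transportMatrix,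
    transpose_pinv, Matrix.mul_assoc]

theorem rangeProj_mul_self (hS : S.PosDef) (hV : V.PosSemidef) :
    rangeProj S V * rangeProj S V = rangeProj S V := by
  have h1 := CFC.sqrt_mul_sqrt_self S hS.posSemidef.nonneg
  have h2 := transportMatrix_mul_mul hS hV
  have h3 := (pinv_penrose (isSymm_of_posSemidef hV)).2.1
  unfold rangeProj
  set T := transportMatrix S V
  calc CFC.sqrt S * T * pinv V * T * CFC.sqrt S * (CFC.sqrt S * T * pinv V * T * CFC.sqrt S)
      = CFC.sqrt S * T * (pinv V * (T * (CFC.sqrt S * CFC.sqrt S) * T) * pinv V) * T *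
          CFC.sqrt S := by simp only [Matrix.mul_assoc]
    _ = CFC.sqrt S * T * pinv V * T * CFC.sqrt S := by
        rw [h1, h2, h3]

theorem posSemidef_one_sub_of_isIdempotent {B : Matrix (Fin n) (Fin n) ℝ}
    (hB : B.transpose = B) (hB2 : B * B = B) : (1 - B).PosSemidef := by
  have h := Matrix.posSemidef_conjTranspose_mul_self (1 - B)
  rw [Matrix.conjTranspose_eq_transpose_of_trivial, Matrix.transpose_sub, hB,
    Matrix.transpose_one] at h
  have e : (1 - B) * (1 - B) = 1 - B := by
    simp [Matrix.mul_sub, Matrix.sub_mul, hB2]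
  rwa [e] at h

variable {Sy : Matrix (Fin m) (Fin m) ℝ} {C : Matrix (Fin n) (Fin m) ℝ}

/-- `S^{1/2} (S^{1/2} V S^{1/2})^{1/2} S^{-1/2} V† C`. -/
def pinvGain (S V : Matrix (Fin n) (Fin n) ℝ) (C : Matrix (Fin n) (Fin m) ℝ) :
    Matrix (Fin n) (Fin m) ℝ :=
  CFC.sqrt S * CFC.sqrt (CFC.sqrt S * V * CFC.sqrt S) * (CFC.sqrt S)⁻¹ * pinv V * C

theorem pinvGain_eq (hS : S.PosDef) : pinvGain S V C = S * transportMatrix S V * pinv V * C := by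
  rw [pinvGain, mul_transportMatrix hS]

theorem posSemidef_mul_inv_mul_transpose (hSy : Sy.PosDef) :
    (C * Sy⁻¹ * C.transpose).PosSemidef := by
  have h := hSy.inv.posSemidef.mul_mul_conjTranspose_same C
  rwa [Matrix.conjTranspose_eq_transpose_of_trivial] at h

theorem transpose_inv_of_posDef (hSy : Sy.PosDef) : (Sy⁻¹).transpose = Sy⁻¹ :=
  isSymm_of_posSemidef hSy.inv.posSemidef

theorem pinvGain_mul (hS : S.PosDef) (hSy : Sy.PosDef) (hV : V = C * Sy⁻¹ * C.transpose) :
    pinvGain S V C * Sy⁻¹ * C.transpose =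
      CFC.sqrt S * CFC.sqrt (CFC.sqrt S * V * CFC.sqrt S) * (CFC.sqrt S)⁻¹ := by
  have hV' : V.PosSemidef := hV ▸ posSemidef_mul_inv_mul_transpose hSy
  rw [pinvGain_eq hS, ← mul_transportMatrix hS]
  calc S * transportMatrix S V * pinv V * C * Sy⁻¹ * C.transpose
      = S * (transportMatrix S V * (pinv V * (C * Sy⁻¹ * C.transpose))) := by
        simp only [Matrix.mul_assoc]
    _ = S * transportMatrix S V := by rw [← hV, transportMatrix_mul_pinv_mul hS hV']

theorem sub_pinvGain (hS : S.PosDef) (hSy : Sy.PosDef) (hV : V = C * Sy⁻¹ * C.transpose) :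
    S - pinvGain S V C * Sy⁻¹ * (pinvGain S V C).transpose =
      CFC.sqrt S * (1 - rangeProj S V) * CFC.sqrt S := by
  have hV' : V.PosSemidef := hV ▸ posSemidef_mul_inv_mul_transpose hSy
  have h1 := CFC.sqrt_mul_sqrt_self S hS.posSemidef.nonneg
  have h3 := (pinv_penrose (isSymm_of_posSemidef hV')).2.1
  rw [pinvGain_eq hS, Matrix.mul_sub, Matrix.sub_mul, Matrix.mul_one, h1]
  congr 1
  simp only [Matrix.transpose_mul, transpose_pinv, transpose_transportMatrix,
    (isSymm_of_posSemidef hS.posSemidef).eq]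
  calc S * transportMatrix S V * pinv V * C * Sy⁻¹ *
        (C.transpose * (pinv V * (transportMatrix S V * S)))
      = S * transportMatrix S V * (pinv V * (C * Sy⁻¹ * C.transpose) * pinv V) *
          transportMatrix S V * S := by simp only [Matrix.mul_assoc]
    _ = S * transportMatrix S V * pinv V * transportMatrix S V * S := by rw [← hV, h3]
    _ = (CFC.sqrt S * CFC.sqrt S) * transportMatrix S V * pinv V * transportMatrix S V *
          (CFC.sqrt S * CFC.sqrt S) := by rw [h1]
    _ = CFC.sqrt S * rangeProj S V * CFC.sqrt S := by
        simp only [rangeProj, Matrix.mul_assoc]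

theorem posSemidef_sqrt_mul_mul_sqrt {A : Matrix (Fin n) (Fin n) ℝ} (hA : A.PosSemidef) :
    (CFC.sqrt S * A * CFC.sqrt S).PosSemidef := by
  have h := hA.mul_mul_conjTranspose_same (CFC.sqrt S)
  rwa [Matrix.conjTranspose_eq_transpose_of_trivial, transpose_sqrt] at h

theorem posSemidef_sub_pinvGain (hS : S.PosDef) (hSy : Sy.PosDef)
    (hV : V = C * Sy⁻¹ * C.transpose) :
    (S - pinvGain S V C * Sy⁻¹ * (pinvGain S V C).transpose).PosSemidef := by
  have hV' : V.PosSemidef := hV ▸ posSemidef_mul_inv_mul_transpose hSy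
  rw [sub_pinvGain hS hSy hV]
  exact posSemidef_sqrt_mul_mul_sqrt
    (posSemidef_one_sub_of_isIdempotent transpose_rangeProj (rangeProj_mul_self hS hV'))

theorem exists_ne_zero_mulVec_eq_zero {p q : ℕ} (A : Matrix (Fin p) (Fin q) ℝ) (h : A.rank < q) :
    ∃ v : Fin q → ℝ, v ≠ 0 ∧ A.mulVec v = 0 := by
  have hlt : Module.finrank ℝ (LinearMap.range A.mulVecLin) <
      Module.finrank ℝ (Fin q → ℝ) := by simpa [Matrix.rank] using h
  have hadd := A.mulVecLin.finrank_range_add_finrank_ker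
  have hpos : 0 < Module.finrank ℝ (LinearMap.ker A.mulVecLin) := by omega
  have : Nontrivial (LinearMap.ker A.mulVecLin) := Module.finrank_pos_iff.1 hpos
  obtain ⟨⟨v, hv⟩, hne⟩ := exists_ne (0 : LinearMap.ker A.mulVecLin)
  exact ⟨v, fun h0 => hne (Subtype.ext h0), by simpa using hv⟩

/-- If `C` has deficient rank, the solution `pinvGain S V C` is not unique. -/
theorem exists_solution_ne_pinvGain (hS : S.PosDef) (hSy : Sy.PosDef)
    (hV : V = C * Sy⁻¹ * C.transpose) (hC : C.rank < min n m) :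
    ∃ M : Matrix (Fin n) (Fin m) ℝ, M * Sy⁻¹ * C.transpose =
        CFC.sqrt S * CFC.sqrt (CFC.sqrt S * V * CFC.sqrt S) * (CFC.sqrt S)⁻¹ ∧
      (S - M * Sy⁻¹ * M.transpose).PosSemidef ∧ M ≠ pinvGain S V C := by
  have hV' : V.PosSemidef := hV ▸ posSemidef_mul_inv_mul_transpose hSy
  have hSyt := transpose_inv_of_posDef hSy
  have hu := isUnit_det_sqrt hS
  have hSyu : IsUnit Sy.det := (Matrix.isUnit_iff_isUnit_det _).1 hSy.isUnit
  obtain ⟨x, hx, hCx⟩ := exists_ne_zero_mulVec_eq_zero C.transpose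
    (by rw [Matrix.rank_transpose]; omega)
  obtain ⟨y, hy, hCy⟩ := exists_ne_zero_mulVec_eq_zero C (by omega)
  set e : Fin n → ℝ := (CFC.sqrt S)⁻¹.mulVec x with he
  have hVx : V * Matrix.replicateCol (Fin 1) x = 0 := by
    rw [hV, Matrix.mul_assoc, ← Matrix.replicateCol_mulVec, hCx]; simp
  have hTx : (transportMatrix S V).mulVec x = 0 := by
    have h := transportMatrix_mul_eq_zero hS hV' hVx
    rw [← Matrix.replicateCol_mulVec] at h
    exact Matrix.replicateCol_injective (ι := Fin 1) (by simpa using h)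
  have hxe : (CFC.sqrt S).mulVec e = x := by
    rw [he, Matrix.mulVec_mulVec, Matrix.mul_nonsing_inv _ hu, Matrix.one_mulVec]
  have hxe' : Matrix.vecMul e (CFC.sqrt S) = x := by
    rw [← transpose_sqrt, Matrix.vecMul_transpose, hxe]
  have hBe : (rangeProj S V).mulVec e = 0 := by
    rw [rangeProj, ← Matrix.mulVec_mulVec, hxe, ← Matrix.mulVec_mulVec, hTx, Matrix.mulVec_zero]
  have hBe' : Matrix.vecMul e (rangeProj S V) = 0 := by
    rw [← transpose_rangeProj, Matrix.vecMul_transpose, hBe]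
  have hene : e ≠ 0 := fun h => hx (by rw [← hxe, h, Matrix.mulVec_zero])
  have hβ : 0 < e ⬝ᵥ e := by
    have h := Matrix.dotProduct_star_self_pos_iff.2 hene
    simpa using h
  have hα : 0 < y ⬝ᵥ Sy.mulVec y := by
    simpa using hSy.dotProduct_mulVec_pos hy
  set β := e ⬝ᵥ e with hβd
  set α := y ⬝ᵥ Sy.mulVec y with hαd
  set c := (√(α * β))⁻¹ with hc
  have hc2 : c * c * α = β⁻¹ := by
    rw [hc, ← mul_inv, Real.mul_self_sqrt (mul_pos hα hβ).le]
    field_simp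
  set N : Matrix (Fin n) (Fin m) ℝ := c • Matrix.vecMulVec x (Matrix.vecMul y Sy) with hN
  have hNSy : N * Sy⁻¹ = c • Matrix.vecMulVec x y := by
    rw [hN, Matrix.smul_mul, Matrix.vecMulVec_mul, Matrix.vecMul_vecMul,
      Matrix.mul_nonsing_inv _ hSyu, Matrix.vecMul_one]
  have hNC : N * Sy⁻¹ * C.transpose = 0 := by
    rw [hNSy, Matrix.smul_mul, Matrix.vecMulVec_mul, Matrix.vecMul_transpose, hCy]
    simp
  have hCN : C * Sy⁻¹ * N.transpose = 0 := by
    have h := congrArg Matrix.transpose hNC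
    simpa only [Matrix.transpose_mul, hSyt, Matrix.transpose_transpose, Matrix.transpose_zero,
      ← Matrix.mul_assoc] using h
  have hNN : N * Sy⁻¹ * N.transpose = β⁻¹ • Matrix.vecMulVec x x := by
    rw [hNSy, hN, Matrix.transpose_smul, Matrix.transpose_vecMulVec, Matrix.smul_mul,
      Matrix.mul_smul, Matrix.vecMulVec_mul_vecMulVec, smul_smul, ← hc2, hαd,
      ← Matrix.vecMul_transpose, (isSymm_of_posSemidef hSy.posSemidef).eq]
    simp [smul_smul]
  set G := pinvGain S V C with hG
  have hGN : G * Sy⁻¹ * N.transpose = 0 := by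
    rw [hG, pinvGain, Matrix.mul_assoc, Matrix.mul_assoc, ← Matrix.mul_assoc C, hCN,
      Matrix.mul_zero]
  have hNG : N * Sy⁻¹ * G.transpose = 0 := by
    have h := congrArg Matrix.transpose hGN
    simpa only [Matrix.transpose_mul, hSyt, Matrix.transpose_transpose, Matrix.transpose_zero,
      ← Matrix.mul_assoc] using h
  refine ⟨G + N, ?_, ?_, ?_⟩
  · rw [Matrix.add_mul, Matrix.add_mul, hNC, add_zero, hG, pinvGain_mul hS hSy hV]
  · set B := rangeProj S V + β⁻¹ • Matrix.vecMulVec e e with hB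
    have hBt : B.transpose = B := by
      rw [hB, Matrix.transpose_add, transpose_rangeProj, Matrix.transpose_smul,
        Matrix.transpose_vecMulVec]
    have hBB : B * B = B := by
      have hee : Matrix.vecMulVec e e * Matrix.vecMulVec e e = β • Matrix.vecMulVec e e := by
        rw [Matrix.vecMulVec_mul_vecMulVec, ← hβd, Matrix.vecMulVec_smul]
      rw [hB, Matrix.add_mul, Matrix.mul_add, Matrix.mul_add, rangeProj_mul_self hS hV',
        Matrix.mul_smul, Matrix.mul_vecMulVec, hBe, Matrix.smul_mul, Matrix.vecMulVec_mul, hBe',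
        Matrix.smul_mul, Matrix.mul_smul, hee, smul_smul β⁻¹ β, inv_mul_cancel₀ hβ.ne']
      simp
    have hfin : S - (G + N) * Sy⁻¹ * (G + N).transpose = CFC.sqrt S * (1 - B) * CFC.sqrt S := by
      have h : S - (G + N) * Sy⁻¹ * (G + N).transpose =
          (S - G * Sy⁻¹ * G.transpose) - β⁻¹ • Matrix.vecMulVec x x := by
        simp only [Matrix.transpose_add, Matrix.add_mul, Matrix.mul_add, hGN, hNG, hNN]
        abel
      rw [h, hG, sub_pinvGain hS hSy hV, hB, ← sub_sub, Matrix.mul_sub (CFC.sqrt S) (1 - _),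
        Matrix.sub_mul, Matrix.mul_smul, Matrix.smul_mul, Matrix.mul_vecMulVec,
        Matrix.vecMulVec_mul, hxe, hxe']
    rw [hfin]
    exact posSemidef_sqrt_mul_mul_sqrt (posSemidef_one_sub_of_isIdempotent hBt hBB)
  · intro h
    have h0 : N = 0 := by simpa using h
    have h1 : β⁻¹ • Matrix.vecMulVec x x = 0 := by rw [← hNN, h0]; simp
    rw [smul_eq_zero, Matrix.vecMulVec_eq_zero] at h1
    rcases h1 with h1 | h1
    · exact (inv_pos.2 hβ).ne' h1
    · exact hx (by tauto)

end Matrices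

/-! ### Covariance matrices of random vectors -/

section Covariance

variable {Ω : Type*} [MeasurableSpace Ω] {μ : Measure Ω} [IsProbabilityMeasure μ] {k m n : ℕ}

/-- The continuous linear map given by a matrix. -/
abbrev matCLM (A : Matrix (Fin m) (Fin n) ℝ) :
    EuclideanSpace ℝ (Fin n) →L[ℝ] EuclideanSpace ℝ (Fin m) :=
  (Matrix.toEuclideanLin A).toContinuousLinearMap

theorem matCLM_apply_coord (A : Matrix (Fin m) (Fin n) ℝ) (y : EuclideanSpace ℝ (Fin n))
    (i : Fin m) : matCLM A y i = ∑ j, A i j * y j := by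
  simp [matCLM, Matrix.toLpLin_apply, Matrix.mulVec, dotProduct]

theorem matCLM_mul (A : Matrix (Fin k) (Fin m) ℝ) (B : Matrix (Fin m) (Fin n) ℝ)
    (y : EuclideanSpace ℝ (Fin n)) : matCLM (A * B) y = matCLM A (matCLM B y) := by
  simp [matCLM, Matrix.toLpLin_apply]

theorem memLp_coord {U : Ω → EuclideanSpace ℝ (Fin m)} (hU : MemLp U 2 μ) (i : Fin m) :
    MemLp (fun ω => U ω i) 2 μ :=
  (EuclideanSpace.proj (𝕜 := ℝ) i).comp_memLp' hU

theorem memLp_matCLM {U : Ω → EuclideanSpace ℝ (Fin n)} (hU : MemLp U 2 μ)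
    (A : Matrix (Fin m) (Fin n) ℝ) : MemLp (fun ω => matCLM A (U ω)) 2 μ :=
  (matCLM A).comp_memLp' hU

theorem transpose_crossCov (U : Ω → EuclideanSpace ℝ (Fin m)) (V : Ω → EuclideanSpace ℝ (Fin n)) :
    (crossCov U V μ).transpose = crossCov V U μ := by
  ext i j
  simp [crossCov, covariance_comm]

theorem crossCov_matCLM_left {U : Ω → EuclideanSpace ℝ (Fin m)}
    {V : Ω → EuclideanSpace ℝ (Fin n)} (hU : MemLp U 2 μ) (hV : MemLp V 2 μ)
    (A : Matrix (Fin k) (Fin m) ℝ) :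
    crossCov (fun ω => matCLM A (U ω)) V μ = A * crossCov U V μ := by
  ext i j
  simp only [crossCov, Matrix.of_apply, Matrix.mul_apply, matCLM_apply_coord]
  rw [covariance_fun_sum_left (fun l => (memLp_coord hU l).const_mul _) (memLp_coord hV j)]
  simp only [covariance_const_mul_left]

theorem crossCov_matCLM_right {U : Ω → EuclideanSpace ℝ (Fin m)}
    {V : Ω → EuclideanSpace ℝ (Fin n)} (hU : MemLp U 2 μ) (hV : MemLp V 2 μ)
    (A : Matrix (Fin k) (Fin n) ℝ) :
    crossCov U (fun ω => matCLM A (V ω)) μ = crossCov U V μ * A.transpose := by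
  rw [← transpose_crossCov, crossCov_matCLM_left hV hU, Matrix.transpose_mul, transpose_crossCov]

theorem covMat_matCLM {U : Ω → EuclideanSpace ℝ (Fin m)} (hU : MemLp U 2 μ)
    (A : Matrix (Fin k) (Fin m) ℝ) :
    covMat (fun ω => matCLM A (U ω)) μ = A * covMat U μ * A.transpose := by
  rw [covMat, crossCov_matCLM_left hU (memLp_matCLM hU A), crossCov_matCLM_right hU hU,
    Matrix.mul_assoc, covMat]

theorem crossCov_add_left {U U' : Ω → EuclideanSpace ℝ (Fin m)}
    {V : Ω → EuclideanSpace ℝ (Fin n)} (hU : MemLp U 2 μ) (hU' : MemLp U' 2 μ)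
    (hV : MemLp V 2 μ) :
    crossCov (fun ω => U ω + U' ω) V μ = crossCov U V μ + crossCov U' V μ := by
  ext i j
  exact covariance_add_left (memLp_coord hU i) (memLp_coord hU' i) (memLp_coord hV j)

theorem crossCov_sub_left {U U' : Ω → EuclideanSpace ℝ (Fin m)}
    {V : Ω → EuclideanSpace ℝ (Fin n)} (hU : MemLp U 2 μ) (hU' : MemLp U' 2 μ)
    (hV : MemLp V 2 μ) :
    crossCov (fun ω => U ω - U' ω) V μ = crossCov U V μ - crossCov U' V μ := by
  ext i j
  exact covariance_sub_left (memLp_coord hU i) (memLp_coord hU' i) (memLp_coord hV j)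

theorem crossCov_add_right {U : Ω → EuclideanSpace ℝ (Fin m)}
    {V V' : Ω → EuclideanSpace ℝ (Fin n)} (hU : MemLp U 2 μ) (hV : MemLp V 2 μ)
    (hV' : MemLp V' 2 μ) :
    crossCov U (fun ω => V ω + V' ω) μ = crossCov U V μ + crossCov U V' μ := by
  ext i j
  exact covariance_add_right (memLp_coord hU i) (memLp_coord hV j) (memLp_coord hV' j)

theorem crossCov_eq_zero_of_indepFun {U : Ω → EuclideanSpace ℝ (Fin m)}
    {V : Ω → EuclideanSpace ℝ (Fin n)} (hU : MemLp U 2 μ) (hV : MemLp V 2 μ)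
    (h : IndepFun U V μ) : crossCov U V μ = 0 := by
  ext i j
  exact (h.comp (φ := fun u : EuclideanSpace ℝ (Fin m) => u i)
    (ψ := fun v : EuclideanSpace ℝ (Fin n) => v j) (by fun_prop) (by fun_prop)).covariance_eq_zero
    (memLp_coord hU i) (memLp_coord hV j)

theorem covMat_add_of_indepFun {U V : Ω → EuclideanSpace ℝ (Fin m)} (hU : MemLp U 2 μ)
    (hV : MemLp V 2 μ) (h : IndepFun U V μ) :
    covMat (fun ω => U ω + V ω) μ = covMat U μ + covMat V μ := by
  rw [covMat, crossCov_add_left hU hV (V := fun ω => U ω + V ω) (hU.add hV), crossCov_add_right hU hU hV,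
    crossCov_add_right hV hU hV, crossCov_eq_zero_of_indepFun hU hV h,
    crossCov_eq_zero_of_indepFun hV hU h.symm, covMat, covMat, add_zero, zero_add]

theorem covMat_congr {U V : Ω → EuclideanSpace ℝ (Fin m)} (h : U =ᵐ[μ] V) :
    covMat U μ = covMat V μ := by
  ext i j
  have hc : ∀ l, (fun ω => U ω l) =ᵐ[μ] fun ω => V ω l := fun l => by
    filter_upwards [h] with ω hω
    rw [hω]
  simp only [covMat, crossCov, Matrix.of_apply, covariance, integral_congr_ae (hc i),
    integral_congr_ae (hc j)]
  refine integral_congr_ae ?_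
  filter_upwards [hc i, hc j] with ω hi hj
  simp only [hi, hj]

theorem covMat_map {Ω' : Type*} [MeasurableSpace Ω'] {Z : Ω → Ω'} (hZ : AEMeasurable Z μ)
    {U : Ω' → EuclideanSpace ℝ (Fin m)} (hU : Measurable U) :
    covMat U (μ.map Z) = covMat (fun ω => U (Z ω)) μ := by
  ext i j
  have hc : ∀ l, AEStronglyMeasurable (fun ω => U ω l) (μ.map Z) := fun l =>
    Measurable.aestronglyMeasurable (by fun_prop)
  exact covariance_map_fun (hc i) (hc j) hZ

theorem integral_coord {U : Ω → EuclideanSpace ℝ (Fin m)} (hU : Integrable U μ) (i : Fin m) :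
    ∫ ω, U ω i ∂μ = (∫ ω, U ω ∂μ) i :=
  ContinuousLinearMap.integral_comp_comm (EuclideanSpace.proj (𝕜 := ℝ) i) hU

theorem integral_inner_eq_trace {U V : Ω → EuclideanSpace ℝ (Fin m)} (hU : MemLp U 2 μ)
    (hV : MemLp V 2 μ) (hU0 : ∫ ω, U ω ∂μ = 0) :
    ∫ ω, inner ℝ (U ω) (V ω) ∂μ = (crossCov U V μ).trace := by
  simp only [PiLp.inner_apply, Matrix.trace, Matrix.diag, crossCov, Matrix.of_apply]
  rw [integral_finsetSum]
  · refine Finset.sum_congr rfl fun i _ => ?_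
    rw [covariance_eq_sub (memLp_coord hU i) (memLp_coord hV i),
      integral_coord (hU.integrable one_le_two), hU0]
    simp [mul_comm]
  · intro i _
    have h := (memLp_coord hU i).integrable_mul (memLp_coord hV i)
    exact h.congr (ae_of_all _ fun ω => by simp [mul_comm])

theorem integral_norm_sq_eq_trace {U : Ω → EuclideanSpace ℝ (Fin m)} (hU : MemLp U 2 μ)
    (hU0 : ∫ ω, U ω ∂μ = 0) : ∫ ω, ‖U ω‖ ^ 2 ∂μ = (covMat U μ).trace := by
  rw [covMat, ← integral_inner_eq_trace hU hU hU0]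
  simp

theorem integral_quadratic_eq_trace {U : Ω → EuclideanSpace ℝ (Fin m)} (hU : MemLp U 2 μ)
    (hU0 : ∫ ω, U ω ∂μ = 0) (A : Matrix (Fin m) (Fin m) ℝ) :
    ∫ ω, inner ℝ (U ω) (matCLM A (U ω)) ∂μ = (A * covMat U μ).trace := by
  rw [integral_inner_eq_trace hU (memLp_matCLM hU A) hU0, crossCov_matCLM_right hU hU,
    ← Matrix.trace_transpose, Matrix.transpose_mul, Matrix.transpose_transpose,
    transpose_crossCov, covMat]

theorem lintegral_enorm_sq {E : Type*} [NormedAddCommGroup E] {U : Ω → E} (hU : MemLp U 2 μ) :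
    ∫⁻ ω, ‖U ω‖ₑ ^ 2 ∂μ = ENNReal.ofReal (∫ ω, ‖U ω‖ ^ 2 ∂μ) := by
  rw [ofReal_integral_eq_lintegral_ofReal (hU.integrable_norm_pow two_ne_zero)
    (ae_of_all _ fun ω => by positivity)]
  refine lintegral_congr fun ω => ?_
  rw [ENNReal.ofReal_pow (norm_nonneg _), ofReal_norm]

theorem lintegral_enorm_sq_eq_trace {U : Ω → EuclideanSpace ℝ (Fin m)} (hU : MemLp U 2 μ)
    (hU0 : ∫ ω, U ω ∂μ = 0) :
    ∫⁻ ω, ‖U ω‖ₑ ^ 2 ∂μ = ENNReal.ofReal (covMat U μ).trace := by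
  rw [lintegral_enorm_sq hU, integral_norm_sq_eq_trace hU hU0]

theorem covariance_inner {U : Ω → EuclideanSpace ℝ (Fin m)} {V : Ω → EuclideanSpace ℝ (Fin n)}
    (hU : MemLp U 2 μ) (hV : MemLp V 2 μ) (x : EuclideanSpace ℝ (Fin m))
    (y : EuclideanSpace ℝ (Fin n)) :
    cov[fun ω => inner ℝ x (U ω), fun ω => inner ℝ y (V ω); μ] =
      ∑ i, ∑ j, x i * (y j * crossCov U V μ i j) := by
  simp only [PiLp.inner_apply, RCLike.inner_apply, conj_trivial]
  rw [covariance_fun_sum_fun_sum (fun i => (memLp_coord hU i).mul_const _)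
    (fun j => (memLp_coord hV j).mul_const _)]
  simp only [covariance_mul_const_left, covariance_mul_const_right, crossCov, Matrix.of_apply]
  refine Finset.sum_congr rfl fun i _ => Finset.sum_congr rfl fun j _ => by ring

/-- Centered Gaussian vectors with the same covariance matrix have the same law. -/
theorem map_eq_of_covMat_eq {Ω' : Type*} [MeasurableSpace Ω'] {μ' : Measure Ω'}
    [IsProbabilityMeasure μ'] {U : Ω → EuclideanSpace ℝ (Fin m)}
    {V : Ω' → EuclideanSpace ℝ (Fin m)} (hU : HasGaussianLaw U μ) (hV : HasGaussianLaw V μ')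
    (hU0 : ∫ ω, U ω ∂μ = 0) (hV0 : ∫ ω, V ω ∂μ' = 0) (h : covMat U μ = covMat V μ') :
    μ.map U = μ'.map V := by
  have := hU.isGaussian_map
  have := hV.isGaussian_map
  refine IsGaussian.ext ?_ ?_
  · simp only [id_eq]
    rw [integral_map hU.aemeasurable (by fun_prop), integral_map hV.aemeasurable (by fun_prop),
      hU0, hV0]
  · ext x y
    rw [covarianceBilin_apply_eq_cov IsGaussian.memLp_two_id,
      covarianceBilin_apply_eq_cov IsGaussian.memLp_two_id,
      covariance_map_fun (by fun_prop) (by fun_prop) hU.aemeasurable,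
      covariance_map_fun (by fun_prop) (by fun_prop) hV.aemeasurable,
      covariance_inner hU.memLp_two hU.memLp_two, covariance_inner hV.memLp_two hV.memLp_two]
    have h' : crossCov U U μ = crossCov V V μ' := h
    rw [h']

theorem indepFun_of_crossCov_eq_zero {U : Ω → EuclideanSpace ℝ (Fin m)}
    {V : Ω → EuclideanSpace ℝ (Fin n)} (h : HasGaussianLaw (fun ω => (U ω, V ω)) μ)
    (h0 : crossCov U V μ = 0) : IndepFun U V μ := by
  refine h.indepFun_of_covariance_inner fun x y => ?_
  rw [covariance_inner h.fst.memLp_two h.snd.memLp_two, h0]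
  simp

theorem covMat_of_hasLaw {S : Matrix (Fin m) (Fin m) ℝ} (hS : S.PosSemidef)
    {W : Ω → EuclideanSpace ℝ (Fin m)} (hW : HasLaw W (multivariateGaussian 0 S) μ) :
    covMat W μ = S := by
  have h := covMat_map hW.aemeasurable (U := id) measurable_id
  rw [hW.map_eq] at h
  rw [show covMat W μ = covMat (fun ω => id (W ω)) μ from rfl, ← h]
  ext i j
  exact covariance_eval_multivariateGaussian hS i j

theorem integral_of_hasLaw {S : Matrix (Fin m) (Fin m) ℝ}
    {W : Ω → EuclideanSpace ℝ (Fin m)} (hW : HasLaw W (multivariateGaussian 0 S) μ) :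
    ∫ ω, W ω ∂μ = 0 := by
  have h := integral_map (f := id) hW.aemeasurable (by fun_prop)
  rw [hW.map_eq] at h
  simpa using h.symm

end Covariance

/-! ### Gaussian regression -/

section Regression

variable {Ω : Type*} [MeasurableSpace Ω] {μ : Measure Ω} [IsProbabilityMeasure μ] {nx ny : ℕ}
  {X : Ω → EuclideanSpace ℝ (Fin nx)} {Y : Ω → EuclideanSpace ℝ (Fin ny)}

/-- The regression matrix `Σ_{XY} Σ_Y⁻¹`. -/
def regMat (X : Ω → EuclideanSpace ℝ (Fin nx)) (Y : Ω → EuclideanSpace ℝ (Fin ny))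
    (μ : Measure Ω) : Matrix (Fin nx) (Fin ny) ℝ :=
  crossCov X Y μ * (covMat Y μ)⁻¹

theorem integral_matCLM {Y : Ω → EuclideanSpace ℝ (Fin ny)} (hY : Integrable Y μ)
    (hY0 : ∫ ω, Y ω ∂μ = 0) (A : Matrix (Fin nx) (Fin ny) ℝ) :
    ∫ ω, matCLM A (Y ω) ∂μ = 0 := by
  rw [ContinuousLinearMap.integral_comp_comm _ hY, hY0, map_zero]

namespace GaussianSetting

theorem memLp_X (h : GaussianSetting X Y μ) : MemLp X 2 μ := h.gaussian.fst.memLp_two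

theorem memLp_Y (h : GaussianSetting X Y μ) : MemLp Y 2 μ := h.gaussian.snd.memLp_two

theorem isUnit_det_Y (h : GaussianSetting X Y μ) : IsUnit (covMat Y μ).det :=
  (Matrix.isUnit_iff_isUnit_det _).1 h.posDef_Y.isUnit

theorem integral_residual (h : GaussianSetting X Y μ) :
    ∫ ω, (X ω - matCLM (regMat X Y μ) (Y ω)) ∂μ = 0 := by
  rw [integral_sub (h.memLp_X.integrable one_le_two)
    ((memLp_matCLM h.memLp_Y _).integrable one_le_two), h.mean_X,
    integral_matCLM (h.memLp_Y.integrable one_le_two) h.mean_Y, sub_zero]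

theorem indepFun_residual (h : GaussianSetting X Y μ) :
    IndepFun (fun ω => X ω - matCLM (regMat X Y μ) (Y ω)) Y μ := by
  refine indepFun_of_crossCov_eq_zero ?_ ?_
  · exact h.gaussian.map_fun ((ContinuousLinearMap.fst ℝ _ _ -
      (matCLM (regMat X Y μ)).comp (ContinuousLinearMap.snd ℝ _ _)).prod
        (ContinuousLinearMap.snd ℝ _ _))
  · rw [crossCov_sub_left h.memLp_X (memLp_matCLM h.memLp_Y _) h.memLp_Y,
      crossCov_matCLM_left h.memLp_Y h.memLp_Y, regMat, Matrix.mul_assoc,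
      show crossCov Y Y μ = covMat Y μ from rfl, Matrix.nonsing_inv_mul _ h.isUnit_det_Y,
      Matrix.mul_one, sub_self]

theorem mmse_ae_eq (h : GaussianSetting X Y μ) :
    mmse X Y μ =ᵐ[μ] fun ω => matCLM (regMat X Y μ) (Y ω) := by
  set Z : Ω → EuclideanSpace ℝ (Fin nx) := fun ω => X ω - matCLM (regMat X Y μ) (Y ω) with hZ
  set L : Ω → EuclideanSpace ℝ (Fin nx) := fun ω => matCLM (regMat X Y μ) (Y ω) with hL
  have hX := h.measurable_X
  have hY := h.measurable_Y
  have hZm : Measurable Z := by fun_prop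
  have hle : MeasurableSpace.comap Y inferInstance ≤ (inferInstance : MeasurableSpace Ω) :=
    hY.comap_le
  have hLi : Integrable L μ := (memLp_matCLM h.memLp_Y _).integrable one_le_two
  have hZi : Integrable Z μ := (h.memLp_X.integrable one_le_two).sub hLi
  have hXZ : X = Z + L := by ext ω; simp [hZ, hL]
  have h1 : μ[Z | MeasurableSpace.comap Y inferInstance] =ᵐ[μ] fun _ => μ[Z] :=
    condExp_indep_eq hZm.comap_le hle (comap_measurable Z).stronglyMeasurable
      h.indepFun_residual
  have h2 : μ[L | MeasurableSpace.comap Y inferInstance] = L :=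
    condExp_of_stronglyMeasurable hle
      (((matCLM (regMat X Y μ)).continuous.measurable.comp
        (comap_measurable Y)).stronglyMeasurable) hLi
  have h3 := condExp_add hZi hLi (MeasurableSpace.comap Y inferInstance)
  rw [← hXZ, h2] at h3
  filter_upwards [h1, h3] with ω e1 e3
  rw [mmse, e3, Pi.add_apply, e1, h.integral_residual, zero_add]

theorem covMat_mmse (h : GaussianSetting X Y μ) :
    covMat (mmse X Y μ) μ =
      crossCov X Y μ * (covMat Y μ)⁻¹ * (crossCov X Y μ).transpose := by
  rw [covMat_congr h.mmse_ae_eq, covMat_matCLM h.memLp_Y, regMat, Matrix.transpose_mul,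
    transpose_inv_of_posDef h.posDef_Y, Matrix.mul_assoc _ _ (covMat Y μ),
    Matrix.nonsing_inv_mul _ h.isUnit_det_Y, Matrix.mul_one, Matrix.mul_assoc]

theorem gStar_eq (h : GaussianSetting X Y μ) :
    gStar X Y μ = √((covMat X μ).trace + (covMat (mmse X Y μ) μ).trace -
      2 * (midRoot X Y μ).trace) := by
  have h0 : ∫ ω, mmse X Y μ ω ∂μ = 0 := by
    rw [integral_congr_ae h.mmse_ae_eq,
      integral_matCLM (h.memLp_Y.integrable one_le_two) h.mean_Y]
  simp [gStar, gelbrich, h.mean_X, h0, midRoot]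

end GaussianSetting

end Regression

/-! ### Couplings and the Gelbrich bound -/

section Transport

theorem inner_matCLM_eq_dotProduct {n : ℕ} (A : Matrix (Fin n) (Fin n) ℝ)
    (x y : EuclideanSpace ℝ (Fin n)) :
    inner ℝ x (matCLM A y) = x.ofLp ⬝ᵥ A.mulVec y.ofLp := by
  simp [matCLM, Matrix.toLpLin_apply, PiLp.inner_apply, dotProduct, mul_comm]

theorem two_mul_inner_le {n : ℕ} {K : Matrix (Fin n) (Fin n) ℝ} (hK : K.PosDef)
    (u v : EuclideanSpace ℝ (Fin n)) :
    2 * inner ℝ u v ≤ inner ℝ u (matCLM K u) + inner ℝ v (matCLM K⁻¹ v) := by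
  have hKu : IsUnit K.det := (Matrix.isUnit_iff_isUnit_det _).1 hK.isUnit
  set w := matCLM K⁻¹ v with hw
  have hKw : matCLM K w = v := by
    rw [hw, ← matCLM_mul, Matrix.mul_nonsing_inv _ hKu]
    simp [matCLM]
  have hsymm : inner ℝ w (matCLM K u) = inner ℝ u v := by
    rw [← hKw, inner_matCLM_eq_dotProduct, inner_matCLM_eq_dotProduct, Matrix.dotProduct_mulVec,
      ← Matrix.mulVec_transpose, (isSymm_of_posSemidef hK.posSemidef).eq, dotProduct_comm]
  have h := hK.posSemidef.dotProduct_mulVec_nonneg (u - w).ofLp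
  rw [star_trivial, ← inner_matCLM_eq_dotProduct, map_sub, hKw, inner_sub_left, inner_sub_right,
    inner_sub_right, hsymm, real_inner_comm v w] at h
  linarith

/-- Gelbrich's lower bound for the transport cost of a coupling. -/
theorem gelbrich_le_integral {Ω : Type*} [MeasurableSpace Ω] {μ : Measure Ω}
    [IsProbabilityMeasure μ] {n : ℕ} {U V : Ω → EuclideanSpace ℝ (Fin n)} (hU : MemLp U 2 μ)
    (hV : MemLp V 2 μ) (hU0 : ∫ ω, U ω ∂μ = 0) (hV0 : ∫ ω, V ω ∂μ = 0)
    (hS : (covMat U μ).PosDef) (hT : (covMat V μ).PosSemidef) :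
    (covMat U μ).trace + (covMat V μ).trace -
      2 * (CFC.sqrt (CFC.sqrt (covMat U μ) * covMat V μ * CFC.sqrt (covMat U μ))).trace ≤
      ∫ ω, ‖U ω - V ω‖ ^ 2 ∂μ := by
  refine le_of_forall_pos_le_add fun δ hδ => ?_
  obtain ⟨ε, hε, hεδ⟩ : ∃ ε : ℝ, 0 < ε ∧ ε * (covMat U μ).trace ≤ δ := by
    have h0 := hS.posSemidef.trace_nonneg
    refine ⟨δ / ((covMat U μ).trace + 1), by positivity, ?_⟩
    rw [div_mul_eq_mul_div, div_le_iff₀ (by positivity)]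
    nlinarith
  have hreg := trace_regularized_le hS hT hε
  set K := transportMatrix (covMat U μ) (covMat V μ) +
    ε • (1 : Matrix (Fin n) (Fin n) ℝ) with hK
  have hKp : K.PosDef := Matrix.PosDef.posSemidef_add (posSemidef_transportMatrix _ _)
    (Matrix.PosDef.one.smul hε)
  have hi : ∀ {A B : Ω → EuclideanSpace ℝ (Fin n)}, MemLp A 2 μ → MemLp B 2 μ →
      Integrable (fun ω => inner ℝ (A ω) (B ω)) μ := fun {A B} hA hB => by
    simp only [PiLp.inner_apply]
    exact integrable_finsetSum _ fun i _ => by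
      simpa [mul_comm, Pi.mul_def] using (memLp_coord hA i).integrable_mul (memLp_coord hB i)
  have hUU := hU.integrable_norm_pow (p := 2) two_ne_zero
  have hVV := hV.integrable_norm_pow (p := 2) two_ne_zero
  have hUK := hi hU (memLp_matCLM hU K)
  have hVK := hi hV (memLp_matCLM hV K⁻¹)
  have hmono : ∫ ω, (‖U ω‖ ^ 2 + ‖V ω‖ ^ 2 - (inner ℝ (U ω) (matCLM K (U ω)) +
      inner ℝ (V ω) (matCLM K⁻¹ (V ω)))) ∂μ ≤ ∫ ω, ‖U ω - V ω‖ ^ 2 ∂μ := by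
    refine integral_mono ((hUU.add hVV).sub (hUK.add hVK))
      ((hU.sub hV).integrable_norm_pow (p := 2) two_ne_zero) fun ω => ?_
    have h := two_mul_inner_le hKp (U ω) (V ω)
    simp only
    rw [norm_sub_sq_real]
    linarith
  rw [integral_sub (f := fun ω => ‖U ω‖ ^ 2 + ‖V ω‖ ^ 2)
    (g := fun ω => inner ℝ (U ω) (matCLM K (U ω)) + inner ℝ (V ω) (matCLM K⁻¹ (V ω)))
    (hUU.add hVV) (hUK.add hVK),
    integral_add hUU hVV, integral_add hUK hVK,
    integral_norm_sq_eq_trace hU hU0, integral_norm_sq_eq_trace hV hV0,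
    integral_quadratic_eq_trace hU hU0, integral_quadratic_eq_trace hV hV0] at hmono
  linarith

theorem map_compProd_prodMkLeft {α β γ : Type*} [MeasurableSpace α] [MeasurableSpace β]
    [MeasurableSpace γ] (π : Measure (α × β)) [SFinite π] (κ : Kernel β γ) [IsSFiniteKernel κ] :
    (π ⊗ₘ Kernel.prodMkLeft α κ).map (fun p => (p.1.2, p.2)) = π.map Prod.snd ⊗ₘ κ := by
  refine Measure.ext_of_lintegral _ fun f hf => ?_
  rw [lintegral_map hf (by fun_prop), Measure.lintegral_compProd (by fun_prop),
    Measure.lintegral_compProd hf, lintegral_map (hf.lintegral_kernel_prod_right') (by fun_prop)]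
  simp

/-- Gluing of two couplings along a common second marginal. -/
theorem exists_gluing {α β γ : Type*} [MeasurableSpace α] [MeasurableSpace β]
    [MeasurableSpace γ] [StandardBorelSpace γ] [Nonempty γ] (π₁ : Measure (α × β))
    (π₂ : Measure (γ × β)) [IsProbabilityMeasure π₁] [IsProbabilityMeasure π₂]
    (h : π₁.map Prod.snd = π₂.map Prod.snd) :
    ∃ ρ : Measure ((α × β) × γ), IsProbabilityMeasure ρ ∧ ρ.map Prod.fst = π₁ ∧
      ρ.map (fun p => (p.2, p.1.2)) = π₂ := by
  set τ := π₂.map Prod.swap with hτ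
  have : IsProbabilityMeasure τ := Measure.isProbabilityMeasure_map (by fun_prop)
  refine ⟨π₁ ⊗ₘ Kernel.prodMkLeft α τ.condKernel, inferInstance, ?_, ?_⟩
  · exact Measure.fst_compProd _ _
  · have h1 := map_compProd_prodMkLeft π₁ τ.condKernel
    have h2 : π₁.map Prod.snd = τ.fst := by
      rw [h, hτ, Measure.fst, Measure.map_map (by fun_prop) (by fun_prop)]
      rfl
    rw [h2, Measure.disintegrate] at h1
    have h3 := congrArg (Measure.map Prod.swap) h1
    have h4 : τ.map Prod.swap = π₂ := by
      rw [hτ, Measure.map_map (by fun_prop) (by fun_prop)]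
      simp
    rw [Measure.map_map (by fun_prop) (by fun_prop), h4] at h3
    exact h3

theorem eLpNorm_two_eq {E Ω : Type*} [NormedAddCommGroup E] [MeasurableSpace Ω] (μ : Measure Ω)
    (f : Ω → E) : eLpNorm f 2 μ = (∫⁻ ω, ‖f ω‖ₑ ^ 2 ∂μ) ^ (1 / 2 : ℝ) := by
  rw [eLpNorm_eq_lintegral_rpow_enorm_toReal (by simp) (by simp)]
  simp

theorem le_rpow_half_iff {a b : ℝ≥0∞} : a ≤ b ^ (1 / 2 : ℝ) ↔ a ^ 2 ≤ b := by
  rw [one_div, ENNReal.le_rpow_inv_iff (by norm_num), ENNReal.rpow_ofNat]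

variable {Ω : Type*} [MeasurableSpace Ω] {μ : Measure Ω} [IsProbabilityMeasure μ] {n : ℕ}
  {U V : Ω → EuclideanSpace ℝ (Fin n)}

/-- Gelbrich's bound for a transport through an intermediate law. -/
theorem gelbrich_le_add (hUm : AEMeasurable U μ) (hVm : AEMeasurable V μ) (hU : MemLp U 2 μ)
    (hV : MemLp V 2 μ) (hU0 : ∫ ω, U ω ∂μ = 0) (hV0 : ∫ ω, V ω ∂μ = 0)
    (hS : (covMat U μ).PosDef) (hT : (covMat V μ).PosSemidef)
    (π₁ π₂ : Measure (EuclideanSpace ℝ (Fin n) × EuclideanSpace ℝ (Fin n)))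
    [IsProbabilityMeasure π₁] [IsProbabilityMeasure π₂]
    (h₁ : π₁.map Prod.fst = μ.map V) (h₂ : π₂.map Prod.fst = μ.map U)
    (h : π₁.map Prod.snd = π₂.map Prod.snd) :
    ENNReal.ofReal √((covMat U μ).trace + (covMat V μ).trace -
      2 * (CFC.sqrt (CFC.sqrt (covMat U μ) * covMat V μ * CFC.sqrt (covMat U μ))).trace) ≤
    (∫⁻ p, ‖p.1 - p.2‖ₑ ^ 2 ∂π₂) ^ (1 / 2 : ℝ) + (∫⁻ p, ‖p.1 - p.2‖ₑ ^ 2 ∂π₁) ^ (1 / 2 : ℝ) := by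
  obtain ⟨ρ, hρ, hρ₁, hρ₂⟩ := exists_gluing π₁ π₂ h
  have hmV : ρ.map (fun p => p.1.1) = μ.map V := by
    rw [← h₁, ← hρ₁, Measure.map_map (by fun_prop) (by fun_prop)]; rfl
  have hmU : ρ.map (fun p => p.2) = μ.map U := by
    rw [← h₂, ← hρ₂, Measure.map_map (by fun_prop) (by fun_prop)]; rfl
  have key : ∀ {Z : Ω → EuclideanSpace ℝ (Fin n)}
      {z : (EuclideanSpace ℝ (Fin n) × EuclideanSpace ℝ (Fin n)) × EuclideanSpace ℝ (Fin n) →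
        EuclideanSpace ℝ (Fin n)}, AEMeasurable Z μ → Measurable z → MemLp Z 2 μ →
      ρ.map z = μ.map Z → MemLp z 2 ρ ∧ ∫ p, z p ∂ρ = ∫ ω, Z ω ∂μ ∧
        covMat z ρ = covMat Z μ := by
    intro Z z hZ hz hZ2 hzZ
    refine ⟨?_, ?_, ?_⟩
    · have h1 : MemLp id 2 (μ.map Z) := (memLp_map_measure_iff (by fun_prop) hZ).2 hZ2
      rw [← hzZ] at h1
      exact (memLp_map_measure_iff (by fun_prop) hz.aemeasurable).1 h1
    · have h1 := integral_map (f := id) hZ (by fun_prop)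
      have h2 := integral_map (f := id) hz.aemeasurable (μ := ρ) (by fun_prop)
      rw [hzZ] at h2
      exact h2.symm.trans h1
    · have h1 := covMat_map hZ (U := id) measurable_id
      have h2 := covMat_map (μ := ρ) hz.aemeasurable (U := id) measurable_id
      rw [hzZ] at h2
      exact h2.symm.trans h1
  obtain ⟨hu1, hu2, hu3⟩ := key hUm measurable_snd hU hmU
  obtain ⟨hv1, hv2, hv3⟩ := key hVm (measurable_fst.comp measurable_fst) hV hmV
  have hb := gelbrich_le_integral hu1 hv1 (hu2.trans hU0) (hv2.trans hV0) (hu3 ▸ hS) (hv3 ▸ hT)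
  rw [hu3, hv3] at hb
  have hLsq := lintegral_enorm_sq (hu1.sub hv1)
  simp only [Pi.sub_apply, Function.comp_apply] at hLsq
  have hL : eLpNorm (fun p : (EuclideanSpace ℝ (Fin n) × EuclideanSpace ℝ (Fin n)) ×
      EuclideanSpace ℝ (Fin n) => p.2 - p.1.1) 2 ρ =
      ENNReal.ofReal √(∫ p, ‖p.2 - p.1.1‖ ^ 2 ∂ρ) := by
    rw [eLpNorm_two_eq, hLsq, Real.sqrt_eq_rpow,
      ENNReal.ofReal_rpow_of_nonneg (integral_nonneg fun _ => by positivity) (by norm_num)]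
  have htri := eLpNorm_add_le (μ := ρ) (p := 2)
    (f := fun p : (EuclideanSpace ℝ (Fin n) × EuclideanSpace ℝ (Fin n)) ×
      EuclideanSpace ℝ (Fin n) => p.2 - p.1.2) (g := fun p => p.1.2 - p.1.1)
    (by fun_prop) (by fun_prop) one_le_two
  have hsum : ((fun p : (EuclideanSpace ℝ (Fin n) × EuclideanSpace ℝ (Fin n)) ×
      EuclideanSpace ℝ (Fin n) => p.2 - p.1.2) + fun p => p.1.2 - p.1.1) =
      fun p => p.2 - p.1.1 := by ext p; simp
  rw [hsum, hL, eLpNorm_two_eq, eLpNorm_two_eq] at htri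
  have e2 : ∫⁻ p, ‖p.1 - p.2‖ₑ ^ 2 ∂π₂ = ∫⁻ p, ‖p.2 - p.1.2‖ₑ ^ 2 ∂ρ := by
    rw [← hρ₂, lintegral_map (by fun_prop) (by fun_prop)]
  have e1 : ∫⁻ p, ‖p.1 - p.2‖ₑ ^ 2 ∂π₁ = ∫⁻ p, ‖p.1.2 - p.1.1‖ₑ ^ 2 ∂ρ := by
    rw [← hρ₁, lintegral_map (by fun_prop) (by fun_prop)]
    refine lintegral_congr fun p => ?_
    rw [← enorm_neg, neg_sub]
  rw [e1, e2]
  exact (ENNReal.ofReal_le_ofReal (Real.sqrt_le_sqrt hb)).trans htri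

end Transport

/-! ### Decomposition of the distortion -/

section Distortion

theorem lintegral_enorm_add_sq {n : ℕ} {ρ : Measure (EuclideanSpace ℝ (Fin n))}
    [IsProbabilityMeasure ρ] (hρ : MemLp id 2 ρ) (h0 : ∫ z, z ∂ρ = 0)
    (c : EuclideanSpace ℝ (Fin n)) :
    ∫⁻ z, ‖z + c‖ₑ ^ 2 ∂ρ = ∫⁻ z, ‖z‖ₑ ^ 2 ∂ρ + ‖c‖ₑ ^ 2 := by
  have hi : Integrable (fun z : EuclideanSpace ℝ (Fin n) => z) ρ := hρ.integrable one_le_two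
  have hsq : Integrable (fun z : EuclideanSpace ℝ (Fin n) => ‖z‖ ^ 2) ρ :=
    hρ.integrable_norm_pow (p := 2) two_ne_zero
  have hin : Integrable (fun z : EuclideanSpace ℝ (Fin n) => 2 * inner ℝ z c) ρ :=
    (hi.inner_const c).const_mul 2
  rw [lintegral_enorm_sq (U := fun z => z + c) (hρ.add (memLp_const c)),
    lintegral_enorm_sq (U := fun z => z) hρ, ← ofReal_norm c,
    ← ENNReal.ofReal_pow (norm_nonneg c),
    ← ENNReal.ofReal_add (integral_nonneg fun _ => by positivity) (by positivity)]
  congr 1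
  simp only [norm_add_sq_real]
  have hin0 : ∫ z, 2 * inner ℝ z c ∂ρ = 0 := by
    rw [integral_const_mul]
    simp_rw [real_inner_comm]
    rw [integral_inner hi, h0]
    simp
  rw [integral_add (f := fun z => ‖z‖ ^ 2 + 2 * inner ℝ z c) (hsq.add hin) (integrable_const _), integral_add hsq hin, hin0]
  simp

variable {Ω : Type*} [MeasurableSpace Ω] {μ : Measure Ω} [IsProbabilityMeasure μ] {nx ny : ℕ}
  {X : Ω → EuclideanSpace ℝ (Fin nx)} {Y : Ω → EuclideanSpace ℝ (Fin ny)}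

theorem GaussianSetting.distortion_eq (h : GaussianSetting X Y μ)
    (κ : Kernel (EuclideanSpace ℝ (Fin ny)) (EuclideanSpace ℝ (Fin nx))) [IsMarkovKernel κ] :
    ∫⁻ p, ‖p.1.1 - p.2‖ₑ ^ 2 ∂((μ.map (fun ω => (X ω, Y ω))) ⊗ₘ
      (Kernel.prodMkLeft (EuclideanSpace ℝ (Fin nx)) κ)) =
    ∫⁻ ω, ‖X ω - matCLM (regMat X Y μ) (Y ω)‖ₑ ^ 2 ∂μ +
      ∫⁻ q, ‖matCLM (regMat X Y μ) q.1 - q.2‖ₑ ^ 2 ∂(μ.map Y ⊗ₘ κ) := by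
  set A := regMat X Y μ
  set Z : Ω → EuclideanSpace ℝ (Fin nx) := fun ω => X ω - matCLM A (Y ω) with hZ
  have hX := h.measurable_X
  have hY := h.measurable_Y
  have hZm : Measurable Z := by fun_prop
  have hind : μ.map (fun ω => (Z ω, Y ω)) = (μ.map Z).prod (μ.map Y) :=
    (indepFun_iff_map_prod_eq_prod_map_map hZm.aemeasurable hY.aemeasurable).1
      h.indepFun_residual
  have : IsProbabilityMeasure (μ.map Z) := Measure.isProbabilityMeasure_map hZm.aemeasurable
  have : IsProbabilityMeasure (μ.map Y) := Measure.isProbabilityMeasure_map hY.aemeasurable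
  have hZ2 : MemLp id 2 (μ.map Z) := (memLp_map_measure_iff (by fun_prop) hZm.aemeasurable).2
    (h.memLp_X.sub (memLp_matCLM h.memLp_Y _))
  have hZ0 : ∫ z, z ∂(μ.map Z) = 0 := by
    rw [integral_map hZm.aemeasurable (by fun_prop)]; exact h.integral_residual
  have : IsProbabilityMeasure (μ.map (fun ω => (X ω, Y ω))) :=
    Measure.isProbabilityMeasure_map (by fun_prop)
  have hmeas : Measurable (fun q : EuclideanSpace ℝ (Fin nx) × EuclideanSpace ℝ (Fin ny) =>
      ∫⁻ x, ‖q.1 + (matCLM A q.2 - x)‖ₑ ^ 2 ∂κ q.2) := by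
    have hf : Measurable (fun r : (EuclideanSpace ℝ (Fin nx) × EuclideanSpace ℝ (Fin ny)) ×
      EuclideanSpace ℝ (Fin nx) => ‖r.1.1 + (matCLM A r.1.2 - r.2)‖ₑ ^ 2) := by fun_prop
    exact hf.lintegral_kernel_prod_right' (κ := Kernel.prodMkLeft (EuclideanSpace ℝ (Fin nx)) κ)
  calc ∫⁻ p, ‖p.1.1 - p.2‖ₑ ^ 2 ∂((μ.map (fun ω => (X ω, Y ω))) ⊗ₘ
      (Kernel.prodMkLeft (EuclideanSpace ℝ (Fin nx)) κ))
      = ∫⁻ ω, ∫⁻ x, ‖Z ω + (matCLM A (Y ω) - x)‖ₑ ^ 2 ∂κ (Y ω) ∂μ := by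
        have hf : Measurable (fun r : (EuclideanSpace ℝ (Fin nx) × EuclideanSpace ℝ (Fin ny)) ×
          EuclideanSpace ℝ (Fin nx) => ‖r.1.1 - r.2‖ₑ ^ 2) := by fun_prop
        rw [Measure.lintegral_compProd hf,
          lintegral_map hf.lintegral_kernel_prod_right' (by fun_prop)]
        simp [hZ]
    _ = ∫⁻ q, ∫⁻ x, ‖q.1 + (matCLM A q.2 - x)‖ₑ ^ 2 ∂κ q.2 ∂((μ.map Z).prod (μ.map Y)) := by
        rw [← hind, lintegral_map hmeas (by fun_prop)]
    _ = ∫⁻ y, ∫⁻ z, ∫⁻ x, ‖z + (matCLM A y - x)‖ₑ ^ 2 ∂κ y ∂(μ.map Z) ∂(μ.map Y) :=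
        lintegral_prod_symm' _ hmeas
    _ = ∫⁻ y, ∫⁻ x, (∫⁻ z, ‖z‖ₑ ^ 2 ∂(μ.map Z) + ‖matCLM A y - x‖ₑ ^ 2) ∂κ y ∂(μ.map Y) := by
        refine lintegral_congr fun y => ?_
        rw [lintegral_lintegral_swap (by fun_prop)]
        exact lintegral_congr fun x => lintegral_enorm_add_sq hZ2 hZ0 _
    _ = ∫⁻ z, ‖z‖ₑ ^ 2 ∂(μ.map Z) +
          ∫⁻ y, ∫⁻ x, ‖matCLM A y - x‖ₑ ^ 2 ∂κ y ∂(μ.map Y) := by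
        simp_rw [lintegral_add_left measurable_const, lintegral_const, measure_univ, mul_one]
        rw [lintegral_add_left measurable_const, lintegral_const, measure_univ, mul_one]
    _ = _ := by
        rw [lintegral_map (by fun_prop) hZm, Measure.lintegral_compProd (by fun_prop)]

theorem GaussianSetting.gStar_le_add (h : GaussianSetting X Y μ)
    {ν : Measure (EuclideanSpace ℝ (Fin nx))}
    (π : Measure (EuclideanSpace ℝ (Fin nx) × EuclideanSpace ℝ (Fin nx)))
    [IsProbabilityMeasure π]
    (h₁ : π.map Prod.fst = μ.map (fun ω => matCLM (regMat X Y μ) (Y ω)))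
    (h₂ : π.map Prod.snd = ν) :
    ENNReal.ofReal (gStar X Y μ) ≤
      W2 (μ.map X) ν + (∫⁻ p, ‖p.1 - p.2‖ₑ ^ 2 ∂π) ^ (1 / 2 : ℝ) := by
  have hX := h.measurable_X
  have hY := h.measurable_Y
  have hcov := covMat_congr h.mmse_ae_eq
  have hpsd : (covMat (fun ω => matCLM (regMat X Y μ) (Y ω)) μ).PosSemidef := by
    rw [← hcov, h.covMat_mmse]
    exact posSemidef_mul_inv_mul_transpose h.posDef_Y
  rw [← tsub_le_iff_right, W2, le_rpow_half_iff]
  refine le_iInf₂ fun π₂ hπ₂ => ?_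
  obtain ⟨hp, hf, hs⟩ := hπ₂
  rw [← le_rpow_half_iff, tsub_le_iff_right, h.gStar_eq, midRoot, hcov]
  exact gelbrich_le_add hX.aemeasurable (by fun_prop) h.memLp_X (memLp_matCLM h.memLp_Y _)
    h.mean_X (integral_matCLM (h.memLp_Y.integrable one_le_two) h.mean_Y _) h.posDef_X hpsd π π₂
    h₁ hf (h₂.trans hs.symm)

/-- Lower bound on the distortion of an estimator with perception index at most `P`. -/
theorem GaussianSetting.le_distortion (h : GaussianSetting X Y μ) {P : ℝ} (hP : 0 ≤ P)
    (κ : Kernel (EuclideanSpace ℝ (Fin ny)) (EuclideanSpace ℝ (Fin nx))) [IsMarkovKernel κ]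
    (hκ : W2 (μ.map X) (κ ∘ₘ (μ.map Y)) ≤ ENNReal.ofReal P) :
    ENNReal.ofReal (gStar X Y μ - P) ^ 2 ≤
      ∫⁻ q, ‖matCLM (regMat X Y μ) q.1 - q.2‖ₑ ^ 2 ∂(μ.map Y ⊗ₘ κ) := by
  have hY := h.measurable_Y
  have : IsProbabilityMeasure (μ.map Y) := Measure.isProbabilityMeasure_map hY.aemeasurable
  set f : EuclideanSpace ℝ (Fin ny) × EuclideanSpace ℝ (Fin nx) →
    EuclideanSpace ℝ (Fin nx) × EuclideanSpace ℝ (Fin nx) :=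
    fun q => (matCLM (regMat X Y μ) q.1, q.2) with hf
  have hfm : Measurable f := by fun_prop
  have : IsProbabilityMeasure ((μ.map Y ⊗ₘ κ).map f) :=
    Measure.isProbabilityMeasure_map hfm.aemeasurable
  have h1 : ((μ.map Y ⊗ₘ κ).map f).map Prod.fst =
      μ.map (fun ω => matCLM (regMat X Y μ) (Y ω)) := by
    have e : Prod.fst ∘ f = (matCLM (regMat X Y μ)) ∘ Prod.fst := rfl
    rw [Measure.map_map (by fun_prop) hfm, e, ← Measure.map_map (by fun_prop) (by fun_prop)]
    rw [show (μ.map Y ⊗ₘ κ).map Prod.fst = μ.map Y from Measure.fst_compProd _ _,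
      Measure.map_map (by fun_prop) hY]
    rfl
  have h2 : ((μ.map Y ⊗ₘ κ).map f).map Prod.snd = κ ∘ₘ (μ.map Y) := by
    rw [Measure.map_map (by fun_prop) hfm, ← Measure.snd_compProd]
    rfl
  have hG := (h.gStar_le_add _ h1 h2).trans (add_le_add hκ le_rfl)
  rw [lintegral_map (by fun_prop) hfm] at hG
  rw [ENNReal.ofReal_sub _ hP]
  have hG' := tsub_le_iff_left.2 hG
  rw [le_rpow_half_iff] at hG'
  exact hG'

end Distortion

/-! ### Optimality of the interpolating estimators -/

section Optimality

variable {Ω : Type*} [MeasurableSpace Ω] {μ : Measure Ω} [IsProbabilityMeasure μ] {nx ny : ℕ}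
  {X : Ω → EuclideanSpace ℝ (Fin nx)} {Y : Ω → EuclideanSpace ℝ (Fin ny)}
  {M : Matrix (Fin nx) (Fin ny) ℝ} {W : Ω → EuclideanSpace ℝ (Fin nx)}

/-- The conditional distribution of `B Y + s W` given `Y`, for `W` independent of `Y` with
law `ρ`. -/
def linearKernel (B : Matrix (Fin nx) (Fin ny) ℝ) (s : ℝ)
    (ρ : Measure (EuclideanSpace ℝ (Fin nx))) :
    Kernel (EuclideanSpace ℝ (Fin ny)) (EuclideanSpace ℝ (Fin nx)) :=
  (Kernel.id ×ₖ Kernel.const _ ρ).map (fun q => matCLM B q.1 + s • q.2)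

instance isMarkovKernel_linearKernel (B : Matrix (Fin nx) (Fin ny) ℝ) (s : ℝ) (ρ : Measure (EuclideanSpace ℝ (Fin nx)))
    [IsProbabilityMeasure ρ] : IsMarkovKernel (linearKernel B s ρ) :=
  Kernel.IsMarkovKernel.map _ (by fun_prop)

theorem lintegral_linearKernel (B : Matrix (Fin nx) (Fin ny) ℝ) (s : ℝ)
    (ρ : Measure (EuclideanSpace ℝ (Fin nx))) [IsProbabilityMeasure ρ]
    (y : EuclideanSpace ℝ (Fin ny)) {f : EuclideanSpace ℝ (Fin nx) → ℝ≥0∞} (hf : Measurable f) :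
    ∫⁻ x, f x ∂(linearKernel B s ρ y) = ∫⁻ w, f (matCLM B y + s • w) ∂ρ := by
  rw [linearKernel, Kernel.lintegral_map _ (by fun_prop) _ hf,
    Kernel.lintegral_prod _ _ _ (by fun_prop), Kernel.id_apply, lintegral_dirac']
  · simp
  · simp only [Kernel.const_apply]
    exact Measurable.lintegral_prod_right' (f := fun p : EuclideanSpace ℝ (Fin ny) ×
      EuclideanSpace ℝ (Fin nx) => f (matCLM B p.1 + s • p.2)) (by fun_prop)

theorem hasCondDistrib_linear (hX : Measurable X) (hY : Measurable Y) (hW : AEMeasurable W μ)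
    (hind : IndepFun W (fun ω => (X ω, Y ω)) μ) (B : Matrix (Fin nx) (Fin ny) ℝ) (s : ℝ) :
    HasCondDistrib (fun ω => matCLM B (Y ω) + s • W ω) (fun ω => (X ω, Y ω))
      (Kernel.prodMkLeft (EuclideanSpace ℝ (Fin nx)) (linearKernel B s (μ.map W))) μ := by
  have : IsProbabilityMeasure (μ.map W) := Measure.isProbabilityMeasure_map hW
  have : IsProbabilityMeasure (μ.map (fun ω => (X ω, Y ω))) :=
    Measure.isProbabilityMeasure_map (by fun_prop)
  refine ⟨by fun_prop, Measure.ext_of_lintegral _ fun f hf => ?_⟩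
  have hlaw := (indepFun_iff_map_prod_eq_prod_map_map (by fun_prop) hW).1 hind.symm
  have hg : Measurable (fun q : (EuclideanSpace ℝ (Fin nx) × EuclideanSpace ℝ (Fin ny)) ×
      EuclideanSpace ℝ (Fin nx) => f (q.1, matCLM B q.1.2 + s • q.2)) := by fun_prop
  rw [lintegral_map' hf.aemeasurable (by fun_prop), Measure.lintegral_compProd hf]
  have h1 : ∀ q : EuclideanSpace ℝ (Fin nx) × EuclideanSpace ℝ (Fin ny),
      ∫⁻ x, f (q, x) ∂(Kernel.prodMkLeft (EuclideanSpace ℝ (Fin nx))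
        (linearKernel B s (μ.map W)) q) =
      ∫⁻ w, f (q, matCLM B q.2 + s • w) ∂(μ.map W) := fun q => by
    rw [Kernel.prodMkLeft_apply, lintegral_linearKernel _ _ _ _ (by fun_prop)]
  simp_rw [h1]
  rw [← lintegral_prod _ hg.aemeasurable, ← hlaw, lintegral_map' hg.aemeasurable (by fun_prop)]

/-- The estimator `X̂₀ = M Σ_Y⁻¹ Y + W`, whose law is that of `X`. -/
def perfectEstimator (Y : Ω → EuclideanSpace ℝ (Fin ny)) (μ : Measure Ω)
    (M : Matrix (Fin nx) (Fin ny) ℝ) (W : Ω → EuclideanSpace ℝ (Fin nx)) (ω : Ω) :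
    EuclideanSpace ℝ (Fin nx) :=
  matCLM (M * (covMat Y μ)⁻¹) (Y ω) + W ω

theorem IsNoise.indepFun_Y {S : Matrix (Fin nx) (Fin nx) ℝ} (hW : IsNoise X Y μ S W) :
    IndepFun Y W μ :=
  (hW.indep.comp (φ := id) (ψ := Prod.snd) measurable_id measurable_snd).symm

theorem IsNoise.hasGaussianLaw {S : Matrix (Fin nx) (Fin nx) ℝ} (hW : IsNoise X Y μ S W) :
    HasGaussianLaw W μ := hW.law.hasGaussianLaw

theorem IsNoise.integral_linear {S : Matrix (Fin nx) (Fin nx) ℝ} (hW : IsNoise X Y μ S W)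
    (h : GaussianSetting X Y μ) (B : Matrix (Fin nx) (Fin ny) ℝ) :
    ∫ ω, (matCLM B (Y ω) + W ω) ∂μ = 0 := by
  rw [integral_add ((memLp_matCLM h.memLp_Y _).integrable one_le_two)
    hW.hasGaussianLaw.integrable, integral_of_hasLaw hW.law,
    integral_matCLM (h.memLp_Y.integrable one_le_two) h.mean_Y, add_zero]

theorem IsNoise.covMat_linear {S : Matrix (Fin nx) (Fin nx) ℝ} (hW : IsNoise X Y μ S W)
    (h : GaussianSetting X Y μ) (hS : S.PosSemidef) (B : Matrix (Fin nx) (Fin ny) ℝ) :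
    covMat (fun ω => matCLM B (Y ω) + W ω) μ = B * covMat Y μ * B.transpose + S := by
  rw [covMat_add_of_indepFun (memLp_matCLM h.memLp_Y B) hW.hasGaussianLaw.memLp_two
    (hW.indepFun_Y.comp (matCLM B).continuous.measurable measurable_id),
    covMat_matCLM h.memLp_Y, covMat_of_hasLaw hS hW.law]

theorem map_perfectEstimator (h : GaussianSetting X Y μ) (hM : IsSolution X Y μ M)
    (hW : IsNoise X Y μ (noiseCov X Y μ M) W) :
    μ.map (perfectEstimator Y μ M W) = μ.map X := by
  have hg : HasGaussianLaw (fun ω => (Y ω, W ω)) μ :=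
    hW.indepFun_Y.hasGaussianLaw h.gaussian.snd hW.hasGaussianLaw
  have hg' : HasGaussianLaw (perfectEstimator Y μ M W) μ :=
    hg.map_fun ((matCLM (M * (covMat Y μ)⁻¹)).comp (ContinuousLinearMap.fst ℝ _ _) +
      ContinuousLinearMap.snd ℝ _ _)
  refine map_eq_of_covMat_eq hg' h.gaussian.fst (hW.integral_linear h _) h.mean_X ?_
  refine (hW.covMat_linear h hM.posSemidef _).trans ?_
  rw [noiseCov, Matrix.transpose_mul, transpose_inv_of_posDef h.posDef_Y,
    Matrix.mul_assoc M, Matrix.nonsing_inv_mul _ h.isUnit_det_Y, Matrix.mul_one,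
    ← Matrix.mul_assoc]
  abel

theorem lintegral_perfectEstimator_sub (h : GaussianSetting X Y μ) (hM : IsSolution X Y μ M)
    (hW : IsNoise X Y μ (noiseCov X Y μ M) W) :
    ∫⁻ ω, ‖perfectEstimator Y μ M W ω - matCLM (regMat X Y μ) (Y ω)‖ₑ ^ 2 ∂μ =
      ENNReal.ofReal (gStar X Y μ) ^ 2 := by
  set B := (M - crossCov X Y μ) * (covMat Y μ)⁻¹ with hB
  have hfun : (fun ω => perfectEstimator Y μ M W ω - matCLM (regMat X Y μ) (Y ω)) =
      fun ω => matCLM B (Y ω) + W ω := by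
    ext1 ω
    simp only [perfectEstimator, hB, regMat, Matrix.sub_mul, matCLM, map_sub]
    simp only [sub_apply]
    abel
  have hmem : MemLp (fun ω => matCLM B (Y ω) + W ω) 2 μ :=
    (memLp_matCLM h.memLp_Y B).add hW.hasGaussianLaw.memLp_two
  have hcov := hW.covMat_linear h hM.posSemidef B
  have htr : (covMat (fun ω => matCLM B (Y ω) + W ω) μ).trace =
      (covMat X μ).trace + (covMat (mmse X Y μ) μ).trace - 2 * (midRoot X Y μ).trace := by
    have h1 : B * covMat Y μ * B.transpose = (M - crossCov X Y μ) * (covMat Y μ)⁻¹ *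
        (M.transpose - (crossCov X Y μ).transpose) := by
      rw [hB, Matrix.transpose_mul, transpose_inv_of_posDef h.posDef_Y,
        Matrix.mul_assoc _ _ (covMat Y μ), Matrix.nonsing_inv_mul _ h.isUnit_det_Y,
        Matrix.mul_one, Matrix.transpose_sub, ← Matrix.mul_assoc]
    have h2 : (M * (covMat Y μ)⁻¹ * (crossCov X Y μ).transpose).trace = (midRoot X Y μ).trace := by
      rw [transpose_crossCov, hM.eq, Matrix.trace_mul_comm, ← Matrix.mul_assoc,
        Matrix.nonsing_inv_mul _ (isUnit_det_sqrt h.posDef_X), Matrix.one_mul]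
    have h3 : (crossCov X Y μ * (covMat Y μ)⁻¹ * M.transpose).trace = (midRoot X Y μ).trace := by
      rw [← h2, ← Matrix.trace_transpose]
      simp only [Matrix.transpose_mul, Matrix.transpose_transpose,
        transpose_inv_of_posDef h.posDef_Y, Matrix.mul_assoc]
    rw [hcov, h1, noiseCov, h.covMat_mmse]
    simp only [Matrix.sub_mul, Matrix.mul_sub, Matrix.trace_add, Matrix.trace_sub, h2, h3]
    ring
  have hlin := lintegral_enorm_sq_eq_trace hmem (hW.integral_linear h B)
  have hnn : 0 ≤ (covMat (fun ω => matCLM B (Y ω) + W ω) μ).trace := by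
    rw [← integral_norm_sq_eq_trace hmem (hW.integral_linear h B)]
    exact integral_nonneg fun _ => by positivity
  simp only [fun ω => congrFun hfun ω]
  rw [hlin, h.gStar_eq, ← htr, ← ENNReal.ofReal_pow (Real.sqrt_nonneg _), Real.sq_sqrt hnn]

theorem estimator_eq (X : Ω → EuclideanSpace ℝ (Fin nx)) (Y : Ω → EuclideanSpace ℝ (Fin ny))
    (μ : Measure Ω) (M : Matrix (Fin nx) (Fin ny) ℝ) (W : Ω → EuclideanSpace ℝ (Fin nx))
    (P : ℝ) (ω : Ω) :
    estimator X Y μ M W P ω = (1 - P / gStar X Y μ) • perfectEstimator Y μ M W ω +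
      (P / gStar X Y μ) • matCLM (regMat X Y μ) (Y ω) := by
  simp only [estimator, perfectEstimator, regMat, matCLM, Matrix.add_mul, Matrix.smul_mul, map_add,
    map_smul, LinearMap.add_apply, LinearMap.smul_apply, LinearMap.coe_toContinuousLinearMap',
    smul_add]
  abel

theorem lintegral_enorm_smul_sq {E : Type*} [NormedAddCommGroup E] [NormedSpace ℝ E]
    (f : Ω → E) {c : ℝ} (hc : 0 ≤ c) {g : ℝ}
    (hf : ∫⁻ ω, ‖f ω‖ₑ ^ 2 ∂μ = ENNReal.ofReal g ^ 2) :
    ∫⁻ ω, ‖c • f ω‖ₑ ^ 2 ∂μ = ENNReal.ofReal (c * g) ^ 2 := by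
  simp_rw [enorm_smul, mul_pow]
  rw [lintegral_const_mul' _ _ (by simp), hf, ← mul_pow, ENNReal.ofReal_mul hc,
    Real.enorm_eq_ofReal hc]

theorem isOptimalEstimator_estimator (h : GaussianSetting X Y μ) (hM : IsSolution X Y μ M)
    (hW : IsNoise X Y μ (noiseCov X Y μ M) W) {P : ℝ} (hP : P ∈ Set.Icc 0 (gStar X Y μ)) :
    IsOptimalEstimator X Y μ P (estimator X Y μ M W P) := by
  obtain ⟨hP0, hPG⟩ := hP
  have hX := h.measurable_X
  have hY := h.measurable_Y
  have hWm := hW.law.aemeasurable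
  set G := gStar X Y μ with hG
  have hG0 : 0 ≤ G := hP0.trans hPG
  set t := P / G with ht
  have htG : t * G = P := by
    rcases hG0.eq_or_lt with h0 | h0
    · rw [← h0, mul_zero]; linarith
    · exact div_mul_cancel₀ _ h0.ne'
  have ht0 : 0 ≤ t := div_nonneg hP0 hG0
  have ht1 : 0 ≤ 1 - t := sub_nonneg.2 (div_le_one_of_le₀ hPG hG0)
  have hsG : (1 - t) * G = G - P := by rw [sub_mul, one_mul, htG]
  set X₀ := perfectEstimator Y μ M W with hX₀
  set Xs : Ω → EuclideanSpace ℝ (Fin nx) := fun ω => matCLM (regMat X Y μ) (Y ω) with hXs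
  set Xh := estimator X Y μ M W P with hXh
  have hXhe : ∀ ω, Xh ω = (1 - t) • X₀ ω + t • Xs ω := estimator_eq X Y μ M W P
  have hX₀m : AEMeasurable X₀ μ := by
    have : AEMeasurable (fun ω => matCLM (M * (covMat Y μ)⁻¹) (Y ω) + W ω) μ := by fun_prop
    exact this
  have hXsm : AEMeasurable Xs μ := by fun_prop
  have hXhm : AEMeasurable Xh μ := by
    have : Xh = fun ω => (1 - t) • X₀ ω + t • Xs ω := funext hXhe
    rw [this]
    fun_prop
  have hbase := lintegral_perfectEstimator_sub h hM hW
  have hcost₁ : ∫⁻ ω, ‖Xs ω - Xh ω‖ₑ ^ 2 ∂μ = ENNReal.ofReal (G - P) ^ 2 := by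
    rw [← hsG, ← lintegral_enorm_smul_sq _ ht1 hbase]
    refine lintegral_congr fun ω => ?_
    rw [← enorm_neg, hXhe]
    congr 2
    module
  have hcost₂ : ∫⁻ ω, ‖X₀ ω - Xh ω‖ₑ ^ 2 ∂μ = ENNReal.ofReal P ^ 2 := by
    rw [← htG, ← lintegral_enorm_smul_sq _ ht0 hbase]
    refine lintegral_congr fun ω => ?_
    rw [hXhe]
    congr 2
    module
  have hroot : ∀ c : ℝ≥0∞, (c ^ 2) ^ (1 / 2 : ℝ) = c := fun c => by
    rw [← ENNReal.rpow_natCast, ← ENNReal.rpow_mul]; simp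
  have hperc : W2 (μ.map X) (μ.map Xh) = ENNReal.ofReal P := by
    refine le_antisymm ?_ ?_
    · rw [← hroot (ENNReal.ofReal P), ← hcost₂, W2]
      refine ENNReal.rpow_le_rpow ?_ (by norm_num)
      refine iInf₂_le_of_le (μ.map fun ω => (X₀ ω, Xh ω)) ⟨?_, ?_, ?_⟩ ?_
      · exact Measure.isProbabilityMeasure_map (by fun_prop)
      · rw [AEMeasurable.map_map_of_aemeasurable (by fun_prop) (by fun_prop),
          ← map_perfectEstimator h hM hW]
        rfl
      · rw [AEMeasurable.map_map_of_aemeasurable (by fun_prop) (by fun_prop)]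
        rfl
      · rw [lintegral_map' (by fun_prop) (by fun_prop)]
    · have : IsProbabilityMeasure (μ.map fun ω => (Xs ω, Xh ω)) :=
        Measure.isProbabilityMeasure_map (by fun_prop)
      have hle := h.gStar_le_add (ν := μ.map Xh) (μ.map fun ω => (Xs ω, Xh ω))
        (by rw [AEMeasurable.map_map_of_aemeasurable (by fun_prop) (by fun_prop)]; rfl)
        (by rw [AEMeasurable.map_map_of_aemeasurable (by fun_prop) (by fun_prop)]; rfl)
      rw [lintegral_map' (by fun_prop) (by fun_prop), hcost₁, hroot, ← tsub_le_iff_right,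
        ← ENNReal.ofReal_sub _ (sub_nonneg.2 hPG), sub_sub_cancel] at hle
      exact hle
  set B := ((1 - t) • M + t • crossCov X Y μ) * (covMat Y μ)⁻¹ with hB
  have hXhB : Xh = fun ω => matCLM B (Y ω) + (1 - t) • W ω := rfl
  set κ := linearKernel B (1 - t) (μ.map W) with hκ
  have hWp : IsProbabilityMeasure (μ.map W) := Measure.isProbabilityMeasure_map hWm
  have hcond : HasCondDistrib Xh (fun ω => (X ω, Y ω))
      (Kernel.prodMkLeft (EuclideanSpace ℝ (Fin nx)) κ) μ :=
    hasCondDistrib_linear hX hY hWm hW.indep B (1 - t)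
  have hκm : IsMarkovKernel κ := inferInstanceAs (IsMarkovKernel (linearKernel B (1 - t) _))
  have : IsProbabilityMeasure (μ.map Y) := Measure.isProbabilityMeasure_map hY.aemeasurable
  have : IsProbabilityMeasure (μ.map (fun ω => (X ω, Y ω))) :=
    Measure.isProbabilityMeasure_map (by fun_prop)
  have hYXh : μ.map (fun ω => (Y ω, Xh ω)) = μ.map Y ⊗ₘ κ := by
    have e := map_compProd_prodMkLeft (μ.map (fun ω => (X ω, Y ω))) κ
    rw [← hcond.map_eq, AEMeasurable.map_map_of_aemeasurable (by fun_prop) (by fun_prop),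
      Measure.map_map (by fun_prop) (by fun_prop)] at e
    exact e
  have hcomp : κ ∘ₘ (μ.map Y) = μ.map Xh := by
    rw [← Measure.snd_compProd, ← hYXh, Measure.snd,
      AEMeasurable.map_map_of_aemeasurable (by fun_prop) (by fun_prop)]
    rfl
  have hdist : ∫⁻ ω, ‖X ω - Xh ω‖ₑ ^ 2 ∂μ =
      ∫⁻ p, ‖p.1.1 - p.2‖ₑ ^ 2 ∂((μ.map (fun ω => (X ω, Y ω))) ⊗ₘ
        (Kernel.prodMkLeft (EuclideanSpace ℝ (Fin nx)) κ)) := by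
    rw [← hcond.map_eq, lintegral_map' (by fun_prop) (by fun_prop)]
  refine ⟨⟨κ, hκm, hcond⟩, ?_, hperc, le_antisymm ?_ ?_⟩
  · exact (memLp_matCLM h.memLp_Y B).add (hW.hasGaussianLaw.memLp_two.const_smul (1 - t))
  · rw [hdist, dpFun]
    refine le_iInf₂ fun κ' hκ' => ?_
    obtain ⟨hm', hw'⟩ := hκ'
    rw [h.distortion_eq κ, h.distortion_eq κ']
    refine add_le_add le_rfl ?_
    refine le_trans (le_of_eq ?_) (h.le_distortion hP0 κ' hw')
    rw [← hYXh, lintegral_map' (by fun_prop) (by fun_prop), ← hcost₁]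
  · rw [hdist, dpFun]
    exact iInf₂_le κ ⟨hκm, by rw [hcomp, hperc]⟩

end Optimality

/-! ### The pseudo-inverse solution and non-uniqueness -/

section PseudoInverse

variable {Ω : Type*} [MeasurableSpace Ω] {μ : Measure Ω} [IsProbabilityMeasure μ] {nx ny : ℕ}
  {X : Ω → EuclideanSpace ℝ (Fin nx)} {Y : Ω → EuclideanSpace ℝ (Fin ny)}

theorem isSolution_pinvCrossCov (h : GaussianSetting X Y μ) :
    IsSolution X Y μ (pinvCrossCov X Y μ) where
  eq := by
    rw [← transpose_crossCov X Y]
    exact pinvGain_mul h.posDef_X h.posDef_Y h.covMat_mmse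
  posSemidef := posSemidef_sub_pinvGain h.posDef_X h.posDef_Y h.covMat_mmse

theorem pinvNoiseCov_eq (h : GaussianSetting X Y μ) :
    pinvNoiseCov X Y μ = noiseCov X Y μ (pinvCrossCov X Y μ) :=
  (sub_pinvGain h.posDef_X h.posDef_Y h.covMat_mmse).symm

theorem pinvEstimator_eq (X : Ω → EuclideanSpace ℝ (Fin nx)) (Y : Ω → EuclideanSpace ℝ (Fin ny))
    (μ : Measure Ω) (W : Ω → EuclideanSpace ℝ (Fin nx)) (P : ℝ) :
    pinvEstimator X Y μ W P = estimator X Y μ (pinvCrossCov X Y μ) W P := by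
  ext1 ω
  simp only [pinvEstimator, estimator, pinvCrossCov, Matrix.add_mul, Matrix.smul_mul,
    Matrix.one_mul]

theorem exists_isSolution_ne (h : GaussianSetting X Y μ)
    (hr : (crossCov X Y μ).rank < min nx ny) :
    ∃ M : Matrix (Fin nx) (Fin ny) ℝ, IsSolution X Y μ M ∧ M ≠ pinvCrossCov X Y μ := by
  obtain ⟨M, h1, h2, h3⟩ :=
    exists_solution_ne_pinvGain h.posDef_X h.posDef_Y h.covMat_mmse hr
  rw [transpose_crossCov] at h1
  exact ⟨M, ⟨h1, h2⟩, h3⟩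

/-- Independent standard Gaussian vectors form a Gaussian setting with `Σ_{XY} = 0`. -/
theorem gaussianSetting_prod (nx ny : ℕ) :
    GaussianSetting
      (Prod.fst : EuclideanSpace ℝ (Fin nx) × EuclideanSpace ℝ (Fin ny) → _) Prod.snd
      ((multivariateGaussian 0 1).prod (multivariateGaussian 0 1)) ∧
    crossCov (Prod.fst : EuclideanSpace ℝ (Fin nx) × EuclideanSpace ℝ (Fin ny) → _) Prod.snd
      ((multivariateGaussian 0 1).prod (multivariateGaussian 0 1)) = 0 := by
  set ρ := (multivariateGaussian (0 : EuclideanSpace ℝ (Fin nx)) 1).prod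
    (multivariateGaussian (0 : EuclideanSpace ℝ (Fin ny)) 1) with hρ
  have hlx : HasLaw (Prod.fst : EuclideanSpace ℝ (Fin nx) × EuclideanSpace ℝ (Fin ny) → _)
      (multivariateGaussian 0 1) ρ := ⟨by fun_prop, by rw [hρ]; simp⟩
  have hly : HasLaw (Prod.snd : EuclideanSpace ℝ (Fin nx) × EuclideanSpace ℝ (Fin ny) → _)
      (multivariateGaussian 0 1) ρ := ⟨by fun_prop, by rw [hρ]; simp⟩
  have hg : HasGaussianLaw (fun p : EuclideanSpace ℝ (Fin nx) × EuclideanSpace ℝ (Fin ny) =>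
      (p.1, p.2)) ρ := IsGaussian.hasGaussianLaw_id
  refine ⟨⟨measurable_fst, measurable_snd, hg, integral_of_hasLaw hlx, integral_of_hasLaw hly,
    ?_, ?_⟩, ?_⟩
  · rw [covMat_of_hasLaw Matrix.PosSemidef.one hlx]; exact Matrix.PosDef.one
  · rw [covMat_of_hasLaw Matrix.PosSemidef.one hly]; exact Matrix.PosDef.one
  · exact crossCov_eq_zero_of_indepFun hg.fst.memLp_two hg.snd.memLp_two
      (indepFun_prod (X := id) (Y := id) measurable_id measurable_id)

end PseudoInverse

end DP

end

theorem theorem5 (nx ny : ℕ) :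
    (∀ {Ω : Type*} [MeasurableSpace Ω] (μ : MeasureTheory.Measure Ω)
        [MeasureTheory.IsProbabilityMeasure μ]
        (X : Ω → EuclideanSpace ℝ (Fin nx)) (Y : Ω → EuclideanSpace ℝ (Fin ny)),
      DP.GaussianSetting X Y μ →
        -- every solution yields an optimal estimator for every perception index in `[0, G*]`
        (∀ M : Matrix (Fin nx) (Fin ny) ℝ, DP.IsSolution X Y μ M →
          ∀ W₀ : Ω → EuclideanSpace ℝ (Fin nx), DP.IsNoise X Y μ (DP.noiseCov X Y μ M) W₀ →
            ∀ P ∈ Set.Icc 0 (DP.gStar X Y μ),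
              DP.IsOptimalEstimator X Y μ P (DP.estimator X Y μ M W₀ P)) ∧
        -- the pseudo-inverse estimator is the member of the family given by one solution
        (DP.IsSolution X Y μ (DP.pinvCrossCov X Y μ) ∧
          DP.pinvNoiseCov X Y μ = DP.noiseCov X Y μ (DP.pinvCrossCov X Y μ) ∧
          ∀ (W : Ω → EuclideanSpace ℝ (Fin nx)) (P : ℝ),
            DP.pinvEstimator X Y μ W P = DP.estimator X Y μ (DP.pinvCrossCov X Y μ) W P) ∧
        -- it is not the only solution when `Σ_{XY}` is not of full rank
        ((DP.crossCov X Y μ).rank < min nx ny →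
          ∃ M : Matrix (Fin nx) (Fin ny) ℝ, DP.IsSolution X Y μ M ∧ M ≠ DP.pinvCrossCov X Y μ)) ∧
    -- in all positive dimensions there are pairs `(X, Y)` with more than one solution
    (1 ≤ nx → 1 ≤ ny →
      ∃ (Ω : Type) (_ : MeasurableSpace Ω) (μ : MeasureTheory.Measure Ω)
        (X : Ω → EuclideanSpace ℝ (Fin nx)) (Y : Ω → EuclideanSpace ℝ (Fin ny)),
        MeasureTheory.IsProbabilityMeasure μ ∧ DP.GaussianSetting X Y μ ∧
          ∃ M : Matrix (Fin nx) (Fin ny) ℝ,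
            DP.IsSolution X Y μ M ∧ M ≠ DP.pinvCrossCov X Y μ) := by
  refine ⟨fun μ _ X Y h => ⟨fun M hM W₀ hW P hP => DP.isOptimalEstimator_estimator h hM hW hP,
    ⟨DP.isSolution_pinvCrossCov h, DP.pinvNoiseCov_eq h, DP.pinvEstimator_eq X Y μ⟩,
    DP.exists_isSolution_ne h⟩, fun hx hy => ?_⟩
  obtain ⟨hset, h0⟩ := DP.gaussianSetting_prod nx ny
  refine ⟨_, inferInstance, _, Prod.fst, Prod.snd, inferInstance, hset,
    DP.exists_isSolution_ne hset ?_⟩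
  rw [h0, Matrix.rank_zero]
  omega
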